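/- Let $q$ be a complex number with $0<|q|<1$. For $n\ge 0$ put $(a;q)_n=\prod_{i=0}^{n-1}(1-aq^i)$. For $n<0$ use the convention $1/(q;q)_n=0$. For integers $N,k$ let $$\begin{bmatrix}N\\k\end{bmatrix}_q=\frac{(q;q)_N}{(q;q)_k\,(q;q)_{N-k}}\quad\text{if }k\ge 0\text{ and }N-k\ge 0,$$ and let it be $0$ otherwise. For an integer $L\ge 0$ and an integer $a$, let $$\Big(\begin{matrix}L,\,a\\a\end{matrix};q\Big)_2=\sum_{n\ge 0}q^{n(n+a)}\frac{(q;q)_L}{(q;q)_n\,(q;q)_{n+a}\,(q;q)_{L-2n-a}},\qquad T_0\Big(\begin{matrix}L\\a\end{matrix};q\Big)=q^{\frac{L^2-a^2}{2}}\Big(\begin{matrix}L,\,a\\a\end{matrix};\frac1q\Big)_2$$ be the Andrews--Baxter $q$-trinomial coefficients (the same formula defines the first one with $1/q$ in place of $q$). In $T_0$ with base $q^6$ the power $(q^6)^{(L^2-a^2)/2}$ means $q^{3(L^2-a^2)}$. **Theorem.** Let $\nu$ be a positive integer and $L$ a non-negative integer, and for non-negative integers $n_1,\dots,n_\nu$ let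 $N_k=n_k+n_{k+1}+\dots+n_\nu$ for $k=1,\dots,\nu$. Then both sums below converge and $$\sum_{\substack{m,n_1,\dots,n_\nu\ge 0\\ L+m\equiv N_1+\dots+N_\nu\ (\mathrm{mod}\ 2)}} q^{m^2+3(N_1^2+\dots+N_\nu^2)}\begin{bmatrix}3n_\nu\\m\end{bmatrix}_{q^2}\begin{bmatrix}2n_\nu+\frac{L-m-N_1-\dots-N_\nu}{2}\\2n_\nu\end{bmatrix}_{q^6}\prod_{j=1}^{\nu-1}\begin{bmatrix}L-\sum_{l=1}^{j}N_l+n_j\\n_j\end{bmatrix}_{q^6}$$ $$=\sum_{j=-\infty}^{\infty}q^{3(\nu+1)j^2+2j}\,T_0\Big(\begin{matrix}L\\(\nu+1)j\end{matrix};q^6\Big).$$ -/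

import Mathlib

open Finset

noncomputable section

namespace QHierarchy

/-- The `q`-Pochhammer symbol `(a;q)_n = (1-a)(1-aq)⋯(1-aq^{n-1})`, for `n ≥ 0`. -/
def qPochhammer (a q : ℂ) (n : ℕ) : ℂ :=
  ∏ i ∈ range n, (1 - a * q ^ i)

/-- The reciprocal `1/(q;q)_n` for an integer `n`, which is `0` for `n < 0`. -/
def invQFactorial (q : ℂ) (n : ℤ) : ℂ :=
  if 0 ≤ n then (qPochhammer q q n.toNat)⁻¹ else 0

/-- The `q`-binomial coefficient with upper entry `N` and lower entry `k`:
`(q;q)_N / ((q;q)_k (q;q)_{N-k})` if `k ≥ 0` and `N - k ≥ 0`, and `0` otherwise. -/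
def qBinomial (q : ℂ) (N k : ℤ) : ℂ :=
  if 0 ≤ k ∧ 0 ≤ N - k then
    qPochhammer q q N.toNat / (qPochhammer q q k.toNat * qPochhammer q q (N - k).toNat)
  else 0

/-- The Andrews–Baxter `q`-trinomial coefficient `(L, b; a; q)_2`, that is
`∑_{n ≥ 0} q^{n(n+b)} (q;q)_L / ((q;q)_n (q;q)_{n+a} (q;q)_{L-2n-a})`.
Only finitely many terms are nonzero (those with `n + a ≥ 0` and `L - 2n - a ≥ 0`). -/
def roundTrinomial (q : ℂ) (L : ℕ) (b a : ℤ) : ℂ :=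
  ∑' n : ℕ, q ^ ((n : ℤ) * (n + b)) *
    (qPochhammer q q L * invQFactorial q n * invQFactorial q (n + a) *
      invQFactorial q ((L : ℤ) - 2 * n - a))

/-- The Andrews–Baxter `q`-trinomial coefficient `T_0(L; a; q)` with base `q = r ^ 2`, that is
`q^{(L²-a²)/2} (L, a; a; 1/q)_2`. The square root `r` of the base is the argument, so
that the possibly half-integral power `q^{(L²-a²)/2} = r^{L²-a²}` is unambiguous. -/
def trinomialT0 (r : ℂ) (L : ℕ) (a : ℤ) : ℂ :=
  r ^ ((L : ℤ) ^ 2 - a ^ 2) * roundTrinomial (r ^ 2)⁻¹ L a a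

/-- `N_k = n_k + n_{k+1} + ⋯ + n_ν`. The indices `1, …, ν` are the elements of `Fin ν`, in order. -/
def tailSum {ν : ℕ} (n : Fin ν → ℕ) (k : Fin ν) : ℕ :=
  ∑ i ∈ Ici k, n i

/-- The index `ν`, as the largest element of `Fin ν`. -/
def lastIndex (ν : ℕ) (hν : 0 < ν) : Fin ν := ⟨ν - 1, Nat.sub_lt hν Nat.one_pos⟩

/-- The `(m, n_1, …, n_ν)` term of the multisum; it is `0` unless
`L + m ≡ N_1 + ⋯ + N_ν (mod 2)`, in which case the division by `2` below is exact. -/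
def hierarchyTerm (ν : ℕ) (hν : 0 < ν) (L : ℕ) (q : ℂ) (m : ℕ) (n : Fin ν → ℕ) : ℂ :=
  if L + m ≡ ∑ k, tailSum n k [MOD 2] then
    q ^ (m ^ 2 + 3 * ∑ k, tailSum n k ^ 2) *
      qBinomial (q ^ 2) (3 * n (lastIndex ν hν)) m *
      qBinomial (q ^ 6)
        (2 * n (lastIndex ν hν) + ((L : ℤ) - m - ∑ k, (tailSum n k : ℤ)) / 2)
        (2 * n (lastIndex ν hν)) *
      ∏ j ∈ Iio (lastIndex ν hν),
        qBinomial (q ^ 6) ((L : ℤ) - ∑ l ∈ Iic j, (tailSum n l : ℤ) + n j) (n j)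
  else 0

end QHierarchy

end

/-! The engine is a two-parameter refinement T(L,M,a,b) of the q-trinomial coefficients
(`refinedTrinomial`, base p = r²) with two properties. As M → ∞ it tends to T₀(L;a)/(p;p)_L
(`tendsto_refinedTrinomial`), and it satisfies Warnaar's transformation
(`refinedTrinomial_transform`): summing r^(i²) [L+M-i; L] T(L-i,i,a,b) over i yields r^(b²)
T(L,M,a+b,b). For a = cj, b = j, each application replaces c by c+1 and contributes r^(j²). With r =
q³ this turns 3(ν+1)j² + 2j into 3(ν+2)j² + 2j.

The transformation is a double-sum computation: two uses of the q-Pfaff–Saalschütz sum amount to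
Sears' transformation (`sears_sum`), and a third evaluates a sum left over (`sum_searsSummand`).
Saalschütz itself is proved by a telescoping recurrence in one parameter.

The iteration starts from c = 1 (`sum_refinedTrinomial_diagonal`): the sum of q^(3j²+2j) T(L,M,j,j)
over j becomes a single sum. Saalschütz linearises the product of two binomials, after which the
exponents decouple. The remaining double sum is a coefficient in (-qX;q²)_{3M}, split into three
products in base q⁶.

On the multisum side the variables N_k play the role of the summation index i. Removing n_1 leaves a
multisum with one variable fewer and L - N_1 in place of L (`hierarchyTerm_succ`), and the removed
binomial is the kernel of the transformation. The outermost sum carries no such binomial, so it is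
handled by the limit M → ∞ (`hierarchySum_limit`), which produces T₀. -/

namespace QHierarchy

/-! ### q-factorials and q-binomials with integer arguments -/

/-- The `q`-factorial `(q;q)_n` for an integer `n`, equal to `1` for `n ≤ 0`. -/
noncomputable def qFactorial (q : ℂ) (n : ℤ) : ℂ := qPochhammer q q n.toNat

theorem one_sub_zpow_ne_zero {q : ℂ} (hq1 : ‖q‖ < 1) {n : ℤ} (hn : 0 < n) :
    1 - q ^ n ≠ 0 := by
  lift n to ℕ using hn.le
  intro h
  have h1 : ‖q ^ n‖ = 1 := by
    rw [zpow_natCast, sub_eq_zero] at h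
    rw [← h, norm_one]
  rw [norm_pow] at h1
  have := pow_lt_one₀ (norm_nonneg q) hq1 (n := n) (by omega)
  linarith

theorem qFactorial_succ (q : ℂ) {n : ℤ} (hn : 0 ≤ n) :
    qFactorial q (n + 1) = qFactorial q n * (1 - q ^ (n + 1)) := by
  lift n to ℕ using hn
  have h : ((n : ℤ) + 1).toNat = n + 1 := by omega
  rw [qFactorial, qFactorial, h, Int.toNat_natCast, qPochhammer, prod_range_succ, qPochhammer]
  congr 2
  rw [← pow_succ']
  norm_cast

theorem qFactorial_ne_zero {q : ℂ} (hq1 : ‖q‖ < 1) (n : ℤ) : qFactorial q n ≠ 0 := by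
  rw [qFactorial, qPochhammer, prod_ne_zero_iff]
  intro i _
  have := one_sub_zpow_ne_zero hq1 (n := (i : ℤ) + 1) (by omega)
  rw [← pow_succ']
  exact_mod_cast this

theorem qFactorial_zero (q : ℂ) : qFactorial q 0 = 1 := by simp [qFactorial, qPochhammer]

theorem invQFactorial_of_neg (q : ℂ) {n : ℤ} (hn : n < 0) : invQFactorial q n = 0 := by
  rw [invQFactorial, if_neg (by omega)]

theorem invQFactorial_of_nonneg (q : ℂ) {n : ℤ} (hn : 0 ≤ n) :
    invQFactorial q n = (qFactorial q n)⁻¹ := by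
  rw [invQFactorial, if_pos hn, qFactorial]

theorem invQFactorial_zero (q : ℂ) : invQFactorial q 0 = 1 := by
  rw [invQFactorial_of_nonneg q le_rfl, qFactorial_zero, inv_one]

theorem nonneg_of_invQFactorial_ne_zero {q : ℂ} {n : ℤ} (h : invQFactorial q n ≠ 0) : 0 ≤ n := by
  by_contra hn
  exact h (invQFactorial_of_neg q (by omega))

theorem qFactorial_mul_inv {q : ℂ} (hq1 : ‖q‖ < 1) {n : ℤ} (hn : 0 ≤ n) :
    qFactorial q n * invQFactorial q n = 1 := by
  rw [invQFactorial_of_nonneg q hn, mul_inv_cancel₀ (qFactorial_ne_zero hq1 n)]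

/-- No sign condition is needed: at n = 0 the factor 1 - q^0 vanishes together with the left side.
Recurrences can therefore cross the boundary of the support. -/
theorem invQFactorial_sub_one {q : ℂ} (hq1 : ‖q‖ < 1) (n : ℤ) :
    invQFactorial q (n - 1) = invQFactorial q n * (1 - q ^ n) := by
  rcases lt_trichotomy n 0 with h | h | h
  · simp [invQFactorial_of_neg q h, invQFactorial_of_neg q (show n - 1 < 0 by omega)]
  · subst h
    simp [invQFactorial]
  · have h1 := qFactorial_succ q (n := n - 1) (by omega)
    rw [sub_add_cancel] at h1
    rw [invQFactorial_of_nonneg q h.le, invQFactorial_of_nonneg q (by omega), h1]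
    have := one_sub_zpow_ne_zero hq1 h
    have := qFactorial_ne_zero hq1 (n - 1)
    field_simp

/-- The support conditions are absorbed by the inverse factorials. The value of `qFactorial` at
negative N never matters, since k ≥ 0 and N - k ≥ 0 force N ≥ 0. -/
theorem qBinomial_eq (q : ℂ) (N k : ℤ) :
    qBinomial q N k = qFactorial q N * invQFactorial q k * invQFactorial q (N - k) := by
  by_cases h1 : 0 ≤ k
  · by_cases h2 : 0 ≤ N - k
    · rw [qBinomial, if_pos ⟨h1, h2⟩, invQFactorial_of_nonneg q h1, invQFactorial_of_nonneg q h2]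
      simp only [qFactorial]
      rw [div_eq_mul_inv, mul_inv, mul_assoc]
    · rw [qBinomial, if_neg (by tauto), invQFactorial_of_neg q (n := N - k) (by omega), mul_zero]
  · rw [qBinomial, if_neg (by tauto), invQFactorial_of_neg q (n := k) (by omega), mul_zero, zero_mul]

theorem le_of_qBinomial_ne_zero {q : ℂ} {N k : ℤ} (h : qBinomial q N k ≠ 0) : 0 ≤ k ∧ k ≤ N := by
  by_contra hn
  exact h (by rw [qBinomial, if_neg (by omega)])

theorem qBinomial_symm (q : ℂ) (N k : ℤ) : qBinomial q N (N - k) = qBinomial q N k := by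
  rw [qBinomial_eq, qBinomial_eq, sub_sub_cancel]
  ring

/-! ### The q-Pfaff–Saalschütz sum -/

/-- The summand of the `q`-Pfaff–Saalschütz sum. -/
noncomputable def saalschutzTerm (q : ℂ) (d A B C j : ℤ) : ℂ :=
  q ^ (j * (j + d)) * qFactorial q (A + B + C + d - j) * invQFactorial q j *
    invQFactorial q (j + d) * invQFactorial q (A - j) * invQFactorial q (B - j) *
    invQFactorial q (C - j)

/-- The telescoping certificate for the `q`-Pfaff–Saalschütz sum. -/
noncomputable def saalschutzCert (q : ℂ) (d A B C j : ℤ) : ℂ :=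
  -q ^ (C + 1 - j) * q ^ (j * (j + d)) * qFactorial q (A + B + C + d + 1 - j) *
    invQFactorial q (j - 1) * invQFactorial q (j + d - 1) * invQFactorial q (A - j) *
    invQFactorial q (B - j) * invQFactorial q (C + 1 - j)

/-- A WZ-style recurrence in C. Once all factorials are reduced to a common set, it is a rational
identity in q, q^j, q^A, q^B, q^C and q^d. The hypothesis serves only to step the numerator
factorial. -/
theorem saalschutz_telescope {q : ℂ} (hq0 : q ≠ 0) (hq1 : ‖q‖ < 1) {d A B C j : ℤ}
    (hj : 0 ≤ A + B + C + d - j) :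
    (1 - q ^ (C + 1)) * (1 - q ^ (C + d + 1)) * saalschutzTerm q d A B (C + 1) j -
      (1 - q ^ (A + C + d + 1)) * (1 - q ^ (B + C + d + 1)) * saalschutzTerm q d A B C j =
    saalschutzCert q d A B C (j + 1) - saalschutzCert q d A B C j := by
  unfold saalschutzTerm saalschutzCert
  have e1 : A + B + (C + 1) + d - j = A + B + C + d - j + 1 := by ring
  have e2 : A + B + C + d + 1 - j = A + B + C + d - j + 1 := by ring
  have e3 : A + B + C + d + 1 - (j + 1) = A + B + C + d - j := by ring
  have e4 : C - j = C + 1 - j - 1 := by ring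
  have e5 : C + 1 - (j + 1) = C + 1 - j - 1 := by ring
  have e6 : A - (j + 1) = A - j - 1 := by ring
  have e7 : B - (j + 1) = B - j - 1 := by ring
  have e8 : j + 1 - 1 = j := by ring
  have e9 : j + 1 + d - 1 = j + d := by ring
  rw [e1, e2, e3, e4, e5, e6, e7, e8, e9]
  simp only [qFactorial_succ q hj, invQFactorial_sub_one hq1]
  generalize qFactorial q (A + B + C + d - j) = f
  generalize invQFactorial q j = i1
  generalize invQFactorial q (j + d) = i2
  generalize invQFactorial q (A - j) = i3
  generalize invQFactorial q (B - j) = i4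
  generalize invQFactorial q (C + 1 - j) = i5
  have p1 : q ^ ((j + 1) * (j + 1 + d)) = q ^ (j * (j + d)) * (q ^ j * q ^ j * q ^ d * q) := by
    rw [← zpow_add₀ hq0, ← zpow_add₀ hq0, ← zpow_add_one₀ hq0, ← zpow_add₀ hq0]
    congr 1; ring
  rw [p1]
  generalize q ^ (j * (j + d)) = w
  simp only [zpow_add₀ hq0, zpow_sub₀ hq0, zpow_one]
  have hx := zpow_ne_zero j hq0
  generalize q ^ j = x at *
  generalize q ^ A = a
  generalize q ^ B = b
  generalize q ^ C = c
  generalize q ^ d = y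
  field_simp
  ring

/-- Induction on C: the telescoped recurrence gives the sum the same first-order recurrence as the
product, because the certificate vanishes at both ends. -/
theorem saalschutz_nat {q : ℂ} (hq0 : q ≠ 0) (hq1 : ‖q‖ < 1) {d A B : ℤ} (hd : 0 ≤ d)
    (hA : 0 ≤ A) (hB : 0 ≤ B) (C : ℕ) :
    ∑ j ∈ range (C + 1), saalschutzTerm q d A B C j =
      qFactorial q (A + B + d) * qFactorial q (A + C + d) * qFactorial q (B + C + d) *
      (invQFactorial q A * invQFactorial q (A + d) * invQFactorial q B * invQFactorial q (B + d) *
        invQFactorial q C * invQFactorial q (C + d)) := by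
  induction C with
  | zero =>
    have h1 := qFactorial_mul_inv hq1 (show 0 ≤ A + d by omega)
    have h2 := qFactorial_mul_inv hq1 (show 0 ≤ B + d by omega)
    simp only [zero_add, sum_range_one, saalschutzTerm, Nat.cast_zero, add_zero, sub_zero, zero_mul,
      zpow_zero, one_mul, invQFactorial_zero, mul_one]
    linear_combination (-qFactorial q (A + B + d) * invQFactorial q A * invQFactorial q B *
      invQFactorial q d * (qFactorial q (B + d) * invQFactorial q (B + d))) * h1 -
      (qFactorial q (A + B + d) * invQFactorial q A * invQFactorial q B *
      invQFactorial q d) * h2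
  | succ C ih =>
    have ht : ∑ j ∈ range (C + 2), saalschutzTerm q d A B C j =
        ∑ j ∈ range (C + 1), saalschutzTerm q d A B C j := by
      rw [sum_range_succ]
      simp [saalschutzTerm, invQFactorial]
    have hs := sum_range_sub (fun j : ℕ => saalschutzCert q d A B C j) (C + 2)
    have h0 : saalschutzCert q d A B C (0 : ℕ) = 0 := by
      simp [saalschutzCert, invQFactorial]
    have h1 : saalschutzCert q d A B C ((C + 2 : ℕ) : ℤ) = 0 := by
      have : invQFactorial q (C + 1 - ((C + 2 : ℕ) : ℤ)) = 0 :=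
        invQFactorial_of_neg q (by push_cast; omega)
      rw [saalschutzCert, this, mul_zero]
    rw [h0, h1, sub_zero] at hs
    have key : (1 - q ^ ((C : ℤ) + 1)) * (1 - q ^ ((C : ℤ) + d + 1)) *
        ∑ j ∈ range (C + 2), saalschutzTerm q d A B (C + 1) j =
        (1 - q ^ (A + C + d + 1)) * (1 - q ^ (B + C + d + 1)) *
        ∑ j ∈ range (C + 2), saalschutzTerm q d A B C j := by
      rw [← sub_eq_zero, mul_sum, mul_sum, ← sum_sub_distrib, ← hs]
      apply sum_congr rfl
      intro j hj
      rw [mem_range] at hj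
      by_cases hd0 : 0 ≤ A + B + C + d - j
      · have := saalschutz_telescope hq0 hq1 hd0
        rw [this]
        push_cast
        rfl
      -- Here j > A, as B, C and d are non-negative, so the terms and both certificates vanish.
      · have hA0 : invQFactorial q (A - j) = 0 := invQFactorial_of_neg q (by omega)
        have hA1 : invQFactorial q (A - (j + 1 : ℕ)) = 0 :=
          invQFactorial_of_neg q (by push_cast; omega)
        simp only [saalschutzTerm, saalschutzCert, hA0, hA1]
        ring
    rw [ht, ih] at key
    have n1 := one_sub_zpow_ne_zero hq1 (n := (C : ℤ) + 1) (by omega)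
    have n2 := one_sub_zpow_ne_zero hq1 (n := (C : ℤ) + d + 1) (by omega)
    have f1 := qFactorial_succ q (n := A + C + d) (by omega)
    have f2 := qFactorial_succ q (n := B + C + d) (by omega)
    have f3 := invQFactorial_sub_one hq1 ((C : ℤ) + 1)
    have f4 := invQFactorial_sub_one hq1 ((C : ℤ) + d + 1)
    rw [add_sub_cancel_right] at f3 f4
    rw [f3, f4] at key
    apply mul_left_cancel₀ (mul_ne_zero n1 n2)
    push_cast
    rw [key, show A + ((C : ℤ) + 1) + d = A + C + d + 1 by ring,
      show B + ((C : ℤ) + 1) + d = B + C + d + 1 by ring,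
      show ((C : ℤ) + 1) + d = C + d + 1 by ring, f1, f2]
    ring

/-- The `q`-Pfaff–Saalschütz sum over any finite set of integers containing its support. -/
theorem saalschutz_int {q : ℂ} (hq0 : q ≠ 0) (hq1 : ‖q‖ < 1) (α β A B C : ℤ) (s : Finset ℤ)
    (hs : ∀ i, α ≤ i → β ≤ i → i ≤ A → i ≤ B → i ≤ C → i ∈ s) :
    ∑ i ∈ s, q ^ ((i - α) * (i - β)) * qFactorial q (A + B + C - α - β - i) *
      invQFactorial q (i - α) * invQFactorial q (i - β) * invQFactorial q (A - i) *
      invQFactorial q (B - i) * invQFactorial q (C - i) =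
    qFactorial q (A + B - α - β) * qFactorial q (A + C - α - β) * qFactorial q (B + C - α - β) *
      (invQFactorial q (A - α) * invQFactorial q (A - β) * invQFactorial q (B - α) *
        invQFactorial q (B - β) * invQFactorial q (C - α) * invQFactorial q (C - β)) := by
  -- The identity is symmetric in α and β. With α the larger, j = i - α starts the sum at 0 and d =
  -- α - β is non-negative.
  wlog hαβ : β ≤ α generalizing α β
  · have := this β α (fun i h1 h2 => hs i h2 h1) (by omega)
    rw [show A + B - β - α = A + B - α - β by ring, show A + C - β - α = A + C - α - β by ring,
      show B + C - β - α = B + C - α - β by ring, show A + B + C - β - α = A + B + C - α - β by ring]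
      at this
    convert this using 1
    · apply sum_congr rfl
      intro i _
      rw [mul_comm (i - α)]
      ring
    · ring
  by_cases h : α ≤ A ∧ α ≤ B ∧ α ≤ C
  · obtain ⟨hA, hB, hC⟩ := h
    have key := saalschutz_nat hq0 hq1 (d := α - β) (A := A - α) (B := B - α) (by omega) (by omega)
      (by omega) (C - α).toNat
    have hc : (((C - α).toNat : ℕ) : ℤ) = C - α := by omega
    rw [hc] at key
    rw [show A + B - α - β = A - α + (B - α) + (α - β) by ring,
      show A + C - α - β = A - α + (C - α) + (α - β) by ring,
      show B + C - α - β = B - α + (C - α) + (α - β) by ring,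
      show A - β = A - α + (α - β) by ring, show B - β = B - α + (α - β) by ring,
      show C - β = C - α + (α - β) by ring, ← key]
    symm
    apply sum_bij_ne_zero (fun (j : ℕ) _ _ => (j : ℤ) + α)
    · intro j hj _
      by_contra hn
      rename_i h0
      apply h0
      by_cases h1 : (j : ℤ) + α ≤ A
      · by_cases h2 : (j : ℤ) + α ≤ B
        · exact absurd (hs _ (by omega) (by omega) h1 h2 (by rw [mem_range] at hj; omega)) hn
        · rw [saalschutzTerm, invQFactorial_of_neg q (n := B - α - j) (by omega)]
          ring
      · rw [saalschutzTerm, invQFactorial_of_neg q (n := A - α - j) (by omega)]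
        ring
    · intro j _ _ k _ _ h
      omega
    · intro i _ h0
      have h1 : 0 ≤ i - α := by
        by_contra hn
        apply h0
        rw [invQFactorial_of_neg q (n := i - α) (by omega)]
        ring
      have h2 : 0 ≤ C - i := by
        by_contra hn
        apply h0
        rw [invQFactorial_of_neg q (n := C - i) (by omega)]
        ring
      refine ⟨(i - α).toNat, by rw [mem_range]; omega, ?_, by omega⟩
      convert h0 using 1
      rw [saalschutzTerm, show (((i - α).toNat : ℕ) : ℤ) = i - α by omega]
      ring_nf
    · intro j _ _
      rw [saalschutzTerm]
      ring_nf
  · have hr : invQFactorial q (A - α) * invQFactorial q (A - β) * invQFactorial q (B - α) *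
        invQFactorial q (B - β) * invQFactorial q (C - α) * invQFactorial q (C - β) = 0 := by
      by_contra h0
      simp only [mul_ne_zero_iff] at h0
      obtain ⟨⟨⟨⟨⟨h1, _⟩, h2⟩, _⟩, h3⟩, _⟩ := h0
      have := nonneg_of_invQFactorial_ne_zero h1
      have := nonneg_of_invQFactorial_ne_zero h2
      have := nonneg_of_invQFactorial_ne_zero h3
      omega
    rw [hr, mul_zero]
    apply sum_eq_zero
    intro i _
    by_contra h0
    simp only [mul_ne_zero_iff] at h0
    obtain ⟨⟨⟨⟨⟨_, h1⟩, _⟩, h2⟩, h3⟩, h4⟩ := h0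
    have := nonneg_of_invQFactorial_ne_zero h1
    have := nonneg_of_invQFactorial_ne_zero h2
    have := nonneg_of_invQFactorial_ne_zero h3
    have := nonneg_of_invQFactorial_ne_zero h4
    omega

/-- The `q`-Pfaff–Saalschütz sum with the summation index reversed. -/
theorem saalschutz_int_reflect {q : ℂ} (hq0 : q ≠ 0) (hq1 : ‖q‖ < 1) (α β A B C : ℤ)
    (s : Finset ℤ) (hs : ∀ i, i ≤ α → i ≤ β → A ≤ i → B ≤ i → C ≤ i → i ∈ s) :
    ∑ i ∈ s, q ^ ((α - i) * (β - i)) * qFactorial q (i + α + β - A - B - C) *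
      invQFactorial q (α - i) * invQFactorial q (β - i) * invQFactorial q (i - A) *
      invQFactorial q (i - B) * invQFactorial q (i - C) =
    qFactorial q (α + β - A - B) * qFactorial q (α + β - A - C) * qFactorial q (α + β - B - C) *
      (invQFactorial q (α - A) * invQFactorial q (β - A) * invQFactorial q (α - B) *
        invQFactorial q (β - B) * invQFactorial q (α - C) * invQFactorial q (β - C)) := by
  have key := saalschutz_int hq0 hq1 (-α) (-β) (-A) (-B) (-C) (s.map (Equiv.neg ℤ).toEmbedding)
    (fun i h1 h2 h3 h4 h5 => by
      rw [mem_map_equiv]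
      exact hs _ (by simp; omega) (by simp; omega) (by simp; omega) (by simp; omega)
        (by simp; omega))
  rw [sum_map] at key
  convert key using 1
  · apply sum_congr rfl
    intro i _
    simp only [Equiv.coe_toEmbedding, Equiv.neg_apply]
    ring_nf
  · ring_nf

/-! ### Refined q-trinomials and Warnaar's transformation -/

/-- A refined `q`-trinomial coefficient in base `r ^ 2`, after Warnaar. -/
noncomputable def refinedTrinomial (r : ℂ) (L M a b : ℤ) : ℂ :=
  ∑ x ∈ Icc 0 L, r ^ ((L - 2 * x - a) ^ 2) * qBinomial (r ^ 2) M (L - 2 * x - a) *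
    qBinomial (r ^ 2) (M + b + x) x * qBinomial (r ^ 2) (M - b + (x + a)) (x + a)

theorem refinedTrinomial_eq_sum (r : ℂ) (L M a b : ℤ) (s : Finset ℤ)
    (hs : ∀ x, 0 ≤ x → 0 ≤ x + a → 2 * x + a ≤ L → x ∈ s) :
    refinedTrinomial r L M a b =
      ∑ x ∈ s, r ^ ((L - 2 * x - a) ^ 2) * qBinomial (r ^ 2) M (L - 2 * x - a) *
        qBinomial (r ^ 2) (M + b + x) x * qBinomial (r ^ 2) (M - b + (x + a)) (x + a) := by
  have key : ∀ x, r ^ ((L - 2 * x - a) ^ 2) * qBinomial (r ^ 2) M (L - 2 * x - a) *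
        qBinomial (r ^ 2) (M + b + x) x * qBinomial (r ^ 2) (M - b + (x + a)) (x + a) ≠ 0 →
      0 ≤ x ∧ 0 ≤ x + a ∧ 2 * x + a ≤ L := by
    intro x h
    simp only [mul_ne_zero_iff] at h
    obtain ⟨⟨⟨_, h1⟩, h2⟩, h3⟩ := h
    have := le_of_qBinomial_ne_zero h1
    have := le_of_qBinomial_ne_zero h2
    have := le_of_qBinomial_ne_zero h3
    omega
  apply sum_bij_ne_zero (fun x _ _ => x)
  · intro x _ h
    obtain ⟨h1, h2, h3⟩ := key x h
    exact hs x h1 h2 h3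
  · intro x _ _ y _ _ h
    exact h
  · intro x _ h
    obtain ⟨h1, h2, h3⟩ := key x h
    exact ⟨x, by rw [mem_Icc]; omega, h, rfl⟩
  · intro x _ _
    rfl

/-- The shift x ↦ x + a exchanges the last two binomials. -/
theorem refinedTrinomial_neg (r : ℂ) (L M a b : ℤ) :
    refinedTrinomial r L M (-a) (-b) = refinedTrinomial r L M a b := by
  rw [refinedTrinomial_eq_sum r L M (-a) (-b) ((Icc 0 L).map (addRightEmbedding a)), sum_map,
    refinedTrinomial]
  · apply sum_congr rfl
    intro x _
    simp only [addRightEmbedding_apply]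
    rw [show L - 2 * (x + a) - -a = L - 2 * x - a by ring, show x + a + -a = x by ring,
      show M - -b + x = M + b + x by ring, show M + -b + (x + a) = M - b + (x + a) by ring]
    ring
  · intro x h1 h2 h3
    rw [mem_map]
    exact ⟨x - a, by rw [mem_Icc]; omega, by simp⟩

/-- Only the supports must be caught by the index sets, so the same interval can serve before and
after a shift. -/
theorem sum_int_shift {s t : Finset ℤ} (i : ℤ) {g : ℤ → ℂ} (hs : ∀ n, g n ≠ 0 → n ∈ s)
    (ht : ∀ n, g n ≠ 0 → n - i ∈ t) : ∑ n ∈ s, g n = ∑ x ∈ t, g (x + i) := by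
  apply sum_bij_ne_zero (fun n _ _ => n - i)
  · intro n _ h
    exact ht n h
  · intro n _ _ m _ _ h
    omega
  · intro x _ h
    exact ⟨x + i, hs _ h, h, by ring⟩
  · intro n _ _
    rw [sub_add_cancel]

/-- The summand of the double sum in the trinomial transformation, with `N = i + x`. -/
noncomputable def transformSummand (r : ℂ) (L M a b N i : ℤ) : ℂ :=
  r ^ (i ^ 2 + (L + i - 2 * N - a) ^ 2) *
    (qFactorial (r ^ 2) (L + M - i) * invQFactorial (r ^ 2) L * invQFactorial (r ^ 2) (M - i)) *
    (qFactorial (r ^ 2) i * invQFactorial (r ^ 2) (L + i - 2 * N - a) *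
      invQFactorial (r ^ 2) (2 * N + a - L)) *
    (qFactorial (r ^ 2) (N + b) * invQFactorial (r ^ 2) (N - i) * invQFactorial (r ^ 2) (i + b)) *
    (qFactorial (r ^ 2) (N + a - b) * invQFactorial (r ^ 2) (N + a - i) *
      invQFactorial (r ^ 2) (i - b))

/-- The summand of the double sum in the trinomial transformation after Sears' transformation. -/
noncomputable def searsSummand (r : ℂ) (L M a b N k : ℤ) : ℂ :=
  r ^ (k ^ 2 + (L + k - 2 * N - a) ^ 2) *
    (qFactorial (r ^ 2) (M + N - k + b) * qFactorial (r ^ 2) (M + L - N) *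
      qFactorial (r ^ 2) b * qFactorial (r ^ 2) (k + L - N - b)) *
    (invQFactorial (r ^ 2) (M - k) * invQFactorial (r ^ 2) (N - k) *
      invQFactorial (r ^ 2) (M + b) * invQFactorial (r ^ 2) (k + L - N) *
      invQFactorial (r ^ 2) (L - N) * invQFactorial (r ^ 2) (L + k - 2 * N - a) *
      invQFactorial (r ^ 2) (k - b) * invQFactorial (r ^ 2) (b + 2 * N + a - L - k))

/-- Sears' transformation by double counting: part of the summand is expanded as a Saalschütz sum
over k, the sums are exchanged, and the sum over i is again of Saalschütz type. -/
theorem sears_sum {r : ℂ} (hr0 : r ≠ 0) (hr1 : ‖r ^ 2‖ < 1) {L a b : ℤ} (M N : ℤ)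
    (hL : 0 ≤ L) (hb : 0 ≤ b) (hab : b ≤ a) :
    ∑ i ∈ Icc 0 L, transformSummand r L M a b N i =
      ∑ k ∈ Icc 0 L, searsSummand r L M a b N k := by
  have hp0 : r ^ 2 ≠ 0 := pow_ne_zero 2 hr0
  obtain ⟨d, hd⟩ : ∃ d, d = 2 * N + a - L := ⟨_, rfl⟩
  -- Outside this region every term on either side vanishes; inside it the factorials to be
  -- cancelled have non-negative arguments.
  by_cases hN : 0 ≤ d ∧ d ≤ N ∧ b ≤ N
  · obtain ⟨hd0, hdN, hbN⟩ := hN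
    have hf1 := qFactorial_mul_inv hr1 hL
    have hf3 := qFactorial_mul_inv hr1 (show 0 ≤ N + b by omega)
    -- The argument equals L - N - b. Its non-negativity is where b ≤ a enters.
    have hf5 := qFactorial_mul_inv hr1 (show 0 ≤ N + a - b - d by omega)
    have hf6 := qFactorial_mul_inv hr1 (show 0 ≤ L - N by omega)
    have hf7 := qFactorial_mul_inv hr1 hb
    obtain rfl : a = d + L - 2 * N := by omega
    have expand : ∀ i ∈ Icc 0 L, transformSummand r L M (d + L - 2 * N) b N i = ∑ k ∈ Icc 0 L,
        r ^ (k ^ 2 + (k - d) ^ 2) * (qFactorial (r ^ 2) b * qFactorial (r ^ 2) (N + b) *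
          qFactorial (r ^ 2) (L - N - b) * qFactorial (r ^ 2) (k + L - N - b) *
          invQFactorial (r ^ 2) L * invQFactorial (r ^ 2) (L - N) *
          invQFactorial (r ^ 2) (b + d - k) * invQFactorial (r ^ 2) (k - d) *
          invQFactorial (r ^ 2) (k - b)) * ((r ^ 2) ^ ((i - k) * (i - -b)) *
          qFactorial (r ^ 2) (M + N + (L - N - b + k) - k - -b - i) *
          invQFactorial (r ^ 2) (i - k) * invQFactorial (r ^ 2) (i - -b) *
          invQFactorial (r ^ 2) (M - i) * invQFactorial (r ^ 2) (N - i) *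
          invQFactorial (r ^ 2) (L - N - b + k - i)) := by
      intro i hi
      rw [mem_Icc] at hi
      have key := saalschutz_int_reflect hp0 hr1 i (b + d) d b (i - (L - N) + b) (Icc 0 L)
        (fun k h1 h2 h3 h4 h5 => by rw [mem_Icc]; omega)
      rw [show i + (b + d) - d - b = i by ring,
        show i + (b + d) - d - (i - (L - N) + b) = L - N by ring,
        show i + (b + d) - b - (i - (L - N) + b) = d + L - N - b by ring,
        show b + d - d = b by ring, show b + d - b = d by ring,
        show i - (i - (L - N) + b) = L - N - b by ring,
        show b + d - (i - (L - N) + b) = d + L - N - i by ring] at key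
      have hf : transformSummand r L M (d + L - 2 * N) b N i =
          (r ^ (i ^ 2 + (i - d) ^ 2) * qFactorial (r ^ 2) (L + M - i) * invQFactorial (r ^ 2) L *
            invQFactorial (r ^ 2) (M - i) * qFactorial (r ^ 2) (N + b) *
            invQFactorial (r ^ 2) (N - i) * invQFactorial (r ^ 2) (i + b) *
            (qFactorial (r ^ 2) b * qFactorial (r ^ 2) (L - N - b) *
              invQFactorial (r ^ 2) (L - N))) *
          (qFactorial (r ^ 2) i * qFactorial (r ^ 2) (L - N) *
            qFactorial (r ^ 2) (d + L - N - b) *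
            (invQFactorial (r ^ 2) (i - d) * invQFactorial (r ^ 2) b *
              invQFactorial (r ^ 2) (i - b) * invQFactorial (r ^ 2) d *
              invQFactorial (r ^ 2) (L - N - b) * invQFactorial (r ^ 2) (d + L - N - i))) := by
        rw [transformSummand, show L + i - 2 * N - (d + L - 2 * N) = i - d by ring,
          show 2 * N + (d + L - 2 * N) - L = d by ring,
          show N + (d + L - 2 * N) - b = d + L - N - b by ring,
          show N + (d + L - 2 * N) - i = d + L - N - i by ring]
        rw [show N + (d + L - 2 * N) - b - d = L - N - b by ring] at hf5
        trans (r ^ (i ^ 2 + (i - d) ^ 2) * qFactorial (r ^ 2) (L + M - i) *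
          invQFactorial (r ^ 2) L *
            invQFactorial (r ^ 2) (M - i) * qFactorial (r ^ 2) (N + b) *
            invQFactorial (r ^ 2) (N - i) * invQFactorial (r ^ 2) (i + b) *
            qFactorial (r ^ 2) i * qFactorial (r ^ 2) (d + L - N - b) *
            invQFactorial (r ^ 2) (i - d) * invQFactorial (r ^ 2) (i - b) *
            invQFactorial (r ^ 2) d * invQFactorial (r ^ 2) (d + L - N - i)) *
            (qFactorial (r ^ 2) b * invQFactorial (r ^ 2) b) *
            (qFactorial (r ^ 2) (L - N - b) * invQFactorial (r ^ 2) (L - N - b)) *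
            (qFactorial (r ^ 2) (L - N) * invQFactorial (r ^ 2) (L - N))
        · rw [hf5, hf6, hf7]
          ring
        · ring
      rw [hf, ← key, mul_sum]
      apply sum_congr rfl
      intro k _
      have hz : r ^ (i ^ 2 + (i - d) ^ 2) * (r ^ 2) ^ ((i - k) * (b + d - k)) =
          r ^ (k ^ 2 + (k - d) ^ 2) * (r ^ 2) ^ ((i - k) * (i - -b)) := by
        rw [← zpow_natCast r 2, ← zpow_mul, ← zpow_mul, ← zpow_add₀ hr0, ← zpow_add₀ hr0]
        congr 1
        push_cast
        ring
      rw [show k + i + (b + d) - d - b - (i - (L - N) + b) = k + L - N - b by ring,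
        show k - (i - (L - N) + b) = L - N - b + k - i by ring,
        show M + N + (L - N - b + k) - k - -b - i = L + M - i by ring,
        show i - -b = i + b by ring] at *
      linear_combination (qFactorial (r ^ 2) (L + M - i) * invQFactorial (r ^ 2) L *
            invQFactorial (r ^ 2) (M - i) * qFactorial (r ^ 2) (N + b) *
            invQFactorial (r ^ 2) (N - i) * invQFactorial (r ^ 2) (i + b) *
            (qFactorial (r ^ 2) b * qFactorial (r ^ 2) (L - N - b) *
              invQFactorial (r ^ 2) (L - N)) * (qFactorial (r ^ 2) (k + L - N - b) *
          invQFactorial (r ^ 2) (i - k) * invQFactorial (r ^ 2) (b + d - k) *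
          invQFactorial (r ^ 2) (k - d) * invQFactorial (r ^ 2) (k - b) *
          invQFactorial (r ^ 2) (L - N - b + k - i))) * hz
    rw [sum_congr rfl expand, sum_comm]
    apply sum_congr rfl
    intro k hk
    rw [mem_Icc] at hk
    rw [← mul_sum, saalschutz_int hp0 hr1 k (-b) M N (L - N - b + k) (Icc 0 L)
      (fun i h1 h2 h3 h4 h5 => by rw [mem_Icc]; omega), searsSummand]
    rw [show M + N - k - -b = M + N - k + b by ring,
      show M + (L - N - b + k) - k - -b = M + L - N by ring,
      show N + (L - N - b + k) - k - -b = L by ring, show M - -b = M + b by ring,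
      show N - -b = N + b by ring, show L - N - b + k - k = L - N - b by ring,
      show L - N - b + k - -b = k + L - N by ring,
      show L + k - 2 * N - (d + L - 2 * N) = k - d by ring,
      show b + 2 * N + (d + L - 2 * N) - L - k = b + d - k by ring]
    rw [show N + (d + L - 2 * N) - b - d = L - N - b by ring] at hf5
    trans (r ^ (k ^ 2 + (k - d) ^ 2) *
      (qFactorial (r ^ 2) (M + N - k + b) * qFactorial (r ^ 2) (M + L - N) *
        qFactorial (r ^ 2) b * qFactorial (r ^ 2) (k + L - N - b)) *
      (invQFactorial (r ^ 2) (M - k) * invQFactorial (r ^ 2) (N - k) *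
        invQFactorial (r ^ 2) (M + b) * invQFactorial (r ^ 2) (k + L - N) *
        invQFactorial (r ^ 2) (L - N) * invQFactorial (r ^ 2) (k - d) *
        invQFactorial (r ^ 2) (k - b) * invQFactorial (r ^ 2) (b + d - k))) *
      (qFactorial (r ^ 2) L * invQFactorial (r ^ 2) L) *
      (qFactorial (r ^ 2) (N + b) * invQFactorial (r ^ 2) (N + b)) *
      (qFactorial (r ^ 2) (L - N - b) * invQFactorial (r ^ 2) (L - N - b))
    · ring
    · rw [hf1, hf3, hf5]
      ring
  · rw [sum_eq_zero, sum_eq_zero]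
    · intro k _
      by_contra h
      simp only [searsSummand, mul_ne_zero_iff] at h
      obtain ⟨_, ⟨⟨⟨⟨⟨⟨⟨h1, h2⟩, h3⟩, h4⟩, h5⟩, h6⟩, h7⟩, h8⟩⟩ := h
      have := nonneg_of_invQFactorial_ne_zero h2
      have := nonneg_of_invQFactorial_ne_zero h6
      have := nonneg_of_invQFactorial_ne_zero h7
      have := nonneg_of_invQFactorial_ne_zero h8
      omega
    · intro i _
      by_contra h
      simp only [transformSummand, mul_ne_zero_iff] at h
      obtain ⟨⟨⟨⟨_, h0⟩, ⟨_, h1⟩, h2⟩, ⟨_, h3⟩, h4⟩, ⟨_, h5⟩, h6⟩ := h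
      have := nonneg_of_invQFactorial_ne_zero h1
      have := nonneg_of_invQFactorial_ne_zero h2
      have := nonneg_of_invQFactorial_ne_zero h3
      have := nonneg_of_invQFactorial_ne_zero h6
      omega

/-- With X = N - k held fixed, the factors (M+N-k+b), (k+L-N) and (k+L-N-b) no longer depend on k,
and the rest is a Saalschütz sum. -/
theorem sum_searsSummand {r : ℂ} (hr0 : r ≠ 0) (hr1 : ‖r ^ 2‖ < 1) {L a b X : ℤ} (M : ℤ)
    (hL : 0 ≤ L) (hX : 0 ≤ X) (hb : 0 ≤ b) (hab : b ≤ a) :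
    ∑ k ∈ Icc 0 L, searsSummand r L M a b (X + k) k =
      r ^ (b ^ 2) * (r ^ ((L - 2 * X - (a + b)) ^ 2) *
        qBinomial (r ^ 2) M (L - 2 * X - (a + b)) * qBinomial (r ^ 2) (M + b + X) X *
        qBinomial (r ^ 2) (M - b + (X + (a + b))) (X + (a + b))) := by
  have hp0 : r ^ 2 ≠ 0 := pow_ne_zero 2 hr0
  obtain ⟨K, hK⟩ : ∃ K, K = L - 2 * X - (a + b) := ⟨_, rfl⟩
  obtain rfl : L = K + 2 * X + a + b := by omega
  rw [show K + 2 * X + a + b - 2 * X - (a + b) = K by ring]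
  have key := saalschutz_int hp0 hr1 b K M (X + a + b + K) (K + b) (Icc 0 (K + 2 * X + a + b))
    (fun i h1 h2 h3 h4 h5 => by rw [mem_Icc]; omega)
  have expand : ∀ k, searsSummand r (K + 2 * X + a + b) M a b (X + k) k =
      r ^ (K ^ 2 + b ^ 2) * (qFactorial (r ^ 2) b * qFactorial (r ^ 2) (X + a + K) *
        invQFactorial (r ^ 2) (X + a + b + K) * qFactorial (r ^ 2) (M + b + X) *
        invQFactorial (r ^ 2) (M + b) * invQFactorial (r ^ 2) X) *
      ((r ^ 2) ^ ((k - b) * (k - K)) *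
        qFactorial (r ^ 2) (M + (X + a + b + K) + (K + b) - b - K - k) *
        invQFactorial (r ^ 2) (k - b) * invQFactorial (r ^ 2) (k - K) *
        invQFactorial (r ^ 2) (M - k) * invQFactorial (r ^ 2) (X + a + b + K - k) *
        invQFactorial (r ^ 2) (K + b - k)) := by
    intro k
    have hz : r ^ (k ^ 2 + (K + b - k) ^ 2) =
        r ^ (K ^ 2 + b ^ 2) * (r ^ 2) ^ ((k - b) * (k - K)) := by
      rw [← zpow_natCast r 2, ← zpow_mul, ← zpow_add₀ hr0]
      congr 1
      push_cast
      ring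
    rw [searsSummand, show K + 2 * X + a + b + k - 2 * (X + k) - a = K + b - k by ring, hz,
      show M + (X + k) - k + b = M + b + X by ring,
      show M + (K + 2 * X + a + b) - (X + k) = M + (X + a + b + K) + (K + b) - b - K - k by ring,
      show k + (K + 2 * X + a + b) - (X + k) - b = X + a + K by ring,
      show X + k - k = X by ring,
      show k + (K + 2 * X + a + b) - (X + k) = X + a + b + K by ring,
      show K + 2 * X + a + b - (X + k) = X + a + b + K - k by ring,
      show b + 2 * (X + k) + a - (K + 2 * X + a + b) - k = k - K by ring]
    ring
  rw [sum_congr rfl (fun k _ => expand k), ← mul_sum, key]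
  simp only [qBinomial_eq]
  rw [show M + (X + a + b + K) - b - K = M - b + (X + (a + b)) by ring,
    show M + (K + b) - b - K = M by ring, show X + a + b + K + (K + b) - b - K = X + a + b + K by ring,
    show X + a + b + K - b = X + a + K by ring, show X + a + b + K - K = X + (a + b) by ring,
    show K + b - b = K by ring, show K + b - K = b by ring,
    show M + b + X - X = M + b by ring, show M - b + (X + (a + b)) - (X + (a + b)) = M - b by ring]
  by_cases hK0 : 0 ≤ K
  · have hf1 := qFactorial_mul_inv hr1 hb
    have hf2 := qFactorial_mul_inv hr1 (show 0 ≤ X + a + K by omega)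
    have hf3 := qFactorial_mul_inv hr1 (show 0 ≤ X + a + b + K by omega)
    trans (r ^ (K ^ 2 + b ^ 2) * (qFactorial (r ^ 2) M * invQFactorial (r ^ 2) K *
      invQFactorial (r ^ 2) (M - K)) * (qFactorial (r ^ 2) (M + b + X) * invQFactorial (r ^ 2) X *
      invQFactorial (r ^ 2) (M + b)) * (qFactorial (r ^ 2) (M - b + (X + (a + b))) *
      invQFactorial (r ^ 2) (X + (a + b)) * invQFactorial (r ^ 2) (M - b))) *
      (qFactorial (r ^ 2) b * invQFactorial (r ^ 2) b) *
      (qFactorial (r ^ 2) (X + a + K) * invQFactorial (r ^ 2) (X + a + K)) *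
      (qFactorial (r ^ 2) (X + a + b + K) * invQFactorial (r ^ 2) (X + a + b + K))
    · ring
    · rw [hf1, hf2, hf3, zpow_add₀ hr0]
      ring
  -- For K < 0 both sides contain 1/(p;p)_K = 0.
  · rw [invQFactorial_of_neg _ (n := K) (by omega)]
    ring

/-- Warnaar's transformation for refined `q`-trinomial coefficients. -/
theorem refinedTrinomial_transform_of_le {r : ℂ} (hr0 : r ≠ 0) (hr1 : ‖r ^ 2‖ < 1) {L a b : ℤ}
    (M : ℤ) (hL : 0 ≤ L) (hb : 0 ≤ b) (hab : b ≤ a) :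
    ∑ i ∈ Icc 0 L, r ^ (i ^ 2) * qBinomial (r ^ 2) (L + M - i) L *
      refinedTrinomial r (L - i) i a b = r ^ (b ^ 2) * refinedTrinomial r L M (a + b) b := by
  have h1 : ∀ i ∈ Icc 0 L, r ^ (i ^ 2) * qBinomial (r ^ 2) (L + M - i) L *
      refinedTrinomial r (L - i) i a b = ∑ N ∈ Icc 0 L, transformSummand r L M a b N i := by
    intro i hi
    rw [mem_Icc] at hi
    have hsupp : ∀ n, transformSummand r L M a b n i ≠ 0 → i ≤ n ∧ n ≤ L := by
      intro n h
      simp only [transformSummand, mul_ne_zero_iff] at h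
      obtain ⟨⟨⟨⟨_, h0⟩, ⟨_, h1⟩, h2⟩, ⟨_, h3⟩, h4⟩, ⟨_, h5⟩, h6⟩ := h
      have := nonneg_of_invQFactorial_ne_zero h1
      have := nonneg_of_invQFactorial_ne_zero h3
      omega
    rw [sum_int_shift (t := Icc 0 L) i
      (fun n h => by have := hsupp n h; rw [mem_Icc]; omega)
      (fun n h => by have := hsupp n h; rw [mem_Icc]; omega),
      refinedTrinomial_eq_sum r (L - i) i a b (Icc 0 L)
      (fun x _ _ _ => by rw [mem_Icc]; omega), mul_sum]
    apply sum_congr rfl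
    intro x _
    rw [transformSummand, zpow_add₀ hr0]
    simp only [qBinomial_eq]
    ring_nf
  have h2 : ∀ k ∈ Icc 0 L, ∑ N ∈ Icc 0 L, searsSummand r L M a b N k =
      ∑ X ∈ Icc 0 L, searsSummand r L M a b (X + k) k := by
    intro k hk
    rw [mem_Icc] at hk
    have hsupp : ∀ n, searsSummand r L M a b n k ≠ 0 → k ≤ n ∧ n ≤ L := by
      intro n h
      simp only [searsSummand, mul_ne_zero_iff] at h
      obtain ⟨_, ⟨⟨⟨⟨⟨⟨⟨h1, h2⟩, h3⟩, h4⟩, h5⟩, h6⟩, h7⟩, h8⟩⟩ := h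
      have := nonneg_of_invQFactorial_ne_zero h2
      have := nonneg_of_invQFactorial_ne_zero h5
      omega
    exact sum_int_shift (t := Icc 0 L) k
      (fun n h => by have := hsupp n h; rw [mem_Icc]; omega)
      (fun n h => by have := hsupp n h; rw [mem_Icc]; omega)
  rw [sum_congr rfl h1, sum_comm]
  simp only [sears_sum hr0 hr1 M _ hL hb hab]
  rw [sum_comm, sum_congr rfl h2, sum_comm, refinedTrinomial, mul_sum]
  apply sum_congr rfl
  intro X hX
  rw [mem_Icc] at hX
  exact sum_searsSummand hr0 hr1 M hL hX.1 hb hab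

/-- For j ≥ 0, c ≥ 1 supplies b ≤ a; negative j reduces to this case by the symmetry (a,b) ↦
(-a,-b). -/
theorem refinedTrinomial_transform {r : ℂ} (hr0 : r ≠ 0) (hr1 : ‖r ^ 2‖ < 1) {L : ℤ} (M : ℤ)
    (hL : 0 ≤ L) {c : ℤ} (hc : 1 ≤ c) (j : ℤ) :
    ∑ i ∈ Icc 0 L, r ^ (i ^ 2) * qBinomial (r ^ 2) (L + M - i) L *
      refinedTrinomial r (L - i) i (c * j) j =
      r ^ (j ^ 2) * refinedTrinomial r L M ((c + 1) * j) j := by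
  rcases le_total 0 j with hj | hj
  · rw [refinedTrinomial_transform_of_le hr0 hr1 M hL hj (by nlinarith)]
    ring_nf
  · have := refinedTrinomial_transform_of_le hr0 hr1 (a := -(c * j)) (b := -j) M hL (by omega)
      (by nlinarith)
    simp only [refinedTrinomial_neg] at this
    rw [this, ← refinedTrinomial_neg r L M ((c + 1) * j)]
    ring_nf
-- Base inversion and the limit M → ∞
open Filter Topology

theorem sum_range_eq_sum_Icc_int (L : ℕ) (g : ℤ → ℂ) :
    ∑ n ∈ range (L + 1), g n = ∑ x ∈ Icc (0 : ℤ) L, g x := by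
  apply sum_bij (fun (n : ℕ) _ => (n : ℤ))
  · intro n hn
    rw [mem_range] at hn
    rw [mem_Icc]
    omega
  · intro n _ m _ h
    exact_mod_cast h
  · intro x hx
    rw [mem_Icc] at hx
    exact ⟨x.toNat, by rw [mem_range]; omega, by omega⟩
  · intro n _
    rfl

theorem qPochhammer_inv {r : ℂ} (hr0 : r ≠ 0) (n : ℕ) :
    qPochhammer (r ^ 2)⁻¹ (r ^ 2)⁻¹ n =
      (-1) ^ n * (r ^ (n * (n + 1)))⁻¹ * qPochhammer (r ^ 2) (r ^ 2) n := by
  induction n with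
  | zero => simp [qPochhammer]
  | succ n ih =>
    rw [qPochhammer, prod_range_succ, ← qPochhammer, ih, qPochhammer, qPochhammer, prod_range_succ]
    simp only [inv_pow, ← pow_mul]
    field_simp
    ring

theorem invQFactorial_inv {r : ℂ} (hr0 : r ≠ 0) (n : ℤ) :
    invQFactorial (r ^ 2)⁻¹ n = (-1) ^ n * r ^ (n * (n + 1)) * invQFactorial (r ^ 2) n := by
  by_cases hn : 0 ≤ n
  · lift n to ℕ using hn
    rw [invQFactorial, if_pos (by omega), invQFactorial, if_pos (by omega), Int.toNat_natCast,
      qPochhammer_inv hr0, mul_inv, mul_inv, inv_inv, ← inv_pow]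
    norm_num
    left
    norm_cast
  · rw [invQFactorial_of_neg _ (by omega), invQFactorial_of_neg _ (by omega), mul_zero]

/-- Inverting the base turns each factorial into a sign and a power of r. The powers combine to a
perfect square exponent, and the signs cancel because the indices sum to 2L. -/
theorem trinomialT0_eq {r : ℂ} (hr0 : r ≠ 0) (L : ℕ) (a : ℤ) :
    trinomialT0 r L a = qFactorial (r ^ 2) L * ∑ x ∈ Icc (0 : ℤ) L, r ^ ((L - 2 * x - a) ^ 2) *
      (invQFactorial (r ^ 2) x * invQFactorial (r ^ 2) (x + a) *
        invQFactorial (r ^ 2) (L - 2 * x - a)) := by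
  rw [trinomialT0, roundTrinomial, tsum_eq_sum (s := range (L + 1)), mul_sum,
    ← sum_range_eq_sum_Icc_int, mul_sum]
  · apply sum_congr rfl
    intro n _
    rw [invQFactorial_inv hr0, invQFactorial_inv hr0, invQFactorial_inv hr0, qPochhammer_inv hr0,
      qFactorial, Int.toNat_natCast, ← zpow_natCast r 2, ← zpow_neg, ← zpow_mul,
      ← zpow_natCast r (L * (L + 1)), ← zpow_natCast (-1 : ℂ) L, ← zpow_neg]
    have hz : r ^ ((L : ℤ) ^ 2 - a ^ 2) * r ^ (-((2 : ℕ) : ℤ) * ((n : ℤ) * (n + a))) *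
        r ^ (-((L * (L + 1) : ℕ) : ℤ)) * r ^ ((n : ℤ) * (n + 1)) *
        r ^ (((n : ℤ) + a) * (n + a + 1)) *
        r ^ (((L : ℤ) - 2 * n - a) * ((L : ℤ) - 2 * n - a + 1)) =
        r ^ (((L : ℤ) - 2 * n - a) ^ 2) := by
      simp only [← zpow_add₀ hr0]
      congr 1
      push_cast
      ring
    have hs : (-1 : ℂ) ^ (L : ℤ) * (-1) ^ (n : ℤ) * (-1) ^ ((n : ℤ) + a) *
        (-1) ^ ((L : ℤ) - 2 * n - a) = 1 := by
      have h1 : (-1 : ℂ) ≠ 0 := by norm_num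
      simp only [← zpow_add₀ h1]
      rw [show (L : ℤ) + n + (n + a) + (L - 2 * n - a) = 2 * L by ring, zpow_mul]
      norm_num
    rw [← hz]
    linear_combination (r ^ ((L : ℤ) ^ 2 - a ^ 2) * r ^ (-((2 : ℕ) : ℤ) * ((n : ℤ) * (n + a))) *
        r ^ (-((L * (L + 1) : ℕ) : ℤ)) * r ^ ((n : ℤ) * (n + 1)) *
        r ^ (((n : ℤ) + a) * (n + a + 1)) *
        r ^ (((L : ℤ) - 2 * n - a) * ((L : ℤ) - 2 * n - a + 1)) *
        qPochhammer (r ^ ((2 : ℕ) : ℤ)) (r ^ ((2 : ℕ) : ℤ)) L *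
        invQFactorial (r ^ ((2 : ℕ) : ℤ)) n * invQFactorial (r ^ ((2 : ℕ) : ℤ)) (n + a) *
        invQFactorial (r ^ ((2 : ℕ) : ℤ)) (L - 2 * n - a)) * hs
  · intro n hn
    rw [mem_range] at hn
    by_contra h
    simp only [mul_ne_zero_iff] at h
    obtain ⟨_, ⟨⟨_, _⟩, h1⟩, h2⟩ := h
    have := nonneg_of_invQFactorial_ne_zero h1
    have := nonneg_of_invQFactorial_ne_zero h2
    omega

theorem trinomialT0_eq_zero {r : ℂ} (hr0 : r ≠ 0) {L : ℕ} {a : ℤ} (h : L < |a|) :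
    trinomialT0 r L a = 0 := by
  rw [trinomialT0_eq hr0, sum_eq_zero, mul_zero]
  intro x hx
  by_contra h0
  simp only [mul_ne_zero_iff] at h0
  obtain ⟨_, ⟨h1, h2⟩, h3⟩ := h0
  have := nonneg_of_invQFactorial_ne_zero h1
  have := nonneg_of_invQFactorial_ne_zero h2
  have := nonneg_of_invQFactorial_ne_zero h3
  rcases abs_cases a with h4 | h4 <;> omega

theorem tendsto_qFactorial_ratio {q : ℂ} (hq0 : q ≠ 0) (hq1 : ‖q‖ < 1) (e : ℤ) (k : ℕ) :
    Tendsto (fun M : ℕ => qFactorial q (M + e) * invQFactorial q (M + e - k)) atTop (𝓝 1) := by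
  induction k with
  | zero =>
    apply Tendsto.congr' _ tendsto_const_nhds
    filter_upwards [eventually_ge_atTop (-e).toNat] with M hM
    rw [Nat.cast_zero, sub_zero, qFactorial_mul_inv hq1 (by omega)]
  | succ k ih =>
    have h1 : Tendsto (fun M : ℕ => 1 - q ^ ((M : ℤ) + e - k)) atTop (𝓝 1) := by
      have h2 : Tendsto (fun M : ℕ => 1 - q ^ M * q ^ (e - k)) atTop (𝓝 (1 - 0 * q ^ (e - k))) :=
        ((tendsto_pow_atTop_nhds_zero_of_norm_lt_one hq1).mul_const _).const_sub 1
      rw [zero_mul, sub_zero] at h2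
      refine h2.congr fun M => ?_
      rw [add_sub_assoc, zpow_add₀ hq0, zpow_natCast]
    have h3 := ih.mul h1
    rw [one_mul] at h3
    refine h3.congr fun M => ?_
    rw [mul_assoc, ← invQFactorial_sub_one hq1, Nat.cast_succ, sub_sub]

theorem tendsto_qBinomial {q : ℂ} (hq0 : q ≠ 0) (hq1 : ‖q‖ < 1) (e k : ℤ) :
    Tendsto (fun M : ℕ => qBinomial q (M + e) k) atTop (𝓝 (invQFactorial q k)) := by
  by_cases hk : 0 ≤ k
  · lift k to ℕ using hk
    have := (tendsto_qFactorial_ratio hq0 hq1 e k).mul_const (invQFactorial q k)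
    rw [one_mul] at this
    refine this.congr fun M => ?_
    rw [qBinomial_eq]
    ring
  · rw [invQFactorial_of_neg q (by omega)]
    refine tendsto_const_nhds.congr fun M => ?_
    rw [qBinomial, if_neg (by omega)]

/-- Each of the three binomials has its upper entry growing with M and a fixed lower entry k, so it
tends to 1/(p;p)_k. The limit does not depend on b. -/
theorem tendsto_refinedTrinomial {r : ℂ} (hr0 : r ≠ 0) (hr1 : ‖r ^ 2‖ < 1) (L : ℕ) (a b : ℤ) :
    Tendsto (fun M : ℕ => refinedTrinomial r L M a b) atTop
      (𝓝 (invQFactorial (r ^ 2) L * trinomialT0 r L a)) := by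
  have hp0 : r ^ 2 ≠ 0 := pow_ne_zero 2 hr0
  rw [trinomialT0_eq hr0, ← mul_assoc, mul_comm (invQFactorial _ _),
    qFactorial_mul_inv hr1 (by omega), one_mul]
  apply tendsto_finsetSum
  intro x _
  have h1 := tendsto_qBinomial hp0 hr1 0 (L - 2 * x - a)
  have h2 := tendsto_qBinomial hp0 hr1 (b + x) x
  have h3 := tendsto_qBinomial hp0 hr1 (-b + (x + a)) (x + a)
  have h := ((h1.const_mul (r ^ ((L - 2 * x - a) ^ 2))).mul h2).mul h3
  convert h using 2
  · simp only [add_zero, sub_eq_add_neg, add_assoc]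
  · ring

/-- The limiting case of Warnaar's transformation. -/
theorem refinedTrinomial_transform_limit {r : ℂ} (hr0 : r ≠ 0) (hr1 : ‖r ^ 2‖ < 1) (L : ℕ)
    {c : ℤ} (hc : 1 ≤ c) (j : ℤ) :
    ∑ i ∈ Icc (0 : ℤ) L, r ^ (i ^ 2) * refinedTrinomial r (L - i) i (c * j) j =
      r ^ (j ^ 2) * trinomialT0 r L ((c + 1) * j) := by
  have hp0 : r ^ 2 ≠ 0 := pow_ne_zero 2 hr0
  have h1 := (tendsto_refinedTrinomial hr0 hr1 L ((c + 1) * j) j).const_mul (r ^ (j ^ 2))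
  have h2 : Tendsto (fun M : ℕ => ∑ i ∈ Icc (0 : ℤ) L, r ^ (i ^ 2) *
      qBinomial (r ^ 2) (L + M - i) L * refinedTrinomial r (L - i) i (c * j) j) atTop
      (𝓝 (∑ i ∈ Icc (0 : ℤ) L, r ^ (i ^ 2) * invQFactorial (r ^ 2) L *
        refinedTrinomial r (L - i) i (c * j) j)) := by
    apply tendsto_finsetSum
    intro i _
    have h3 := tendsto_qBinomial hp0 hr1 (L - i) L
    have h4 := (h3.const_mul (r ^ (i ^ 2))).mul_const (refinedTrinomial r (L - i) i (c * j) j)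
    refine h4.congr fun M => ?_
    rw [show (M : ℤ) + (L - i) = L + M - i by ring]
  have h5 := tendsto_nhds_unique
    (h2.congr fun M : ℕ => refinedTrinomial_transform hr0 hr1 (M : ℤ) (L := L) (by omega) hc j) h1
  have h6 := qFactorial_mul_inv hr1 (n := (L : ℤ)) (by omega)
  have h7 : invQFactorial (r ^ 2) L ≠ 0 := right_ne_zero_of_mul_eq_one h6
  apply mul_left_cancel₀ h7
  rw [mul_sum]
  trans ∑ i ∈ Icc (0 : ℤ) L, r ^ (i ^ 2) * invQFactorial (r ^ 2) L *
        refinedTrinomial r (L - i) i (c * j) j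
  · apply sum_congr rfl
    intro i _
    ring
  · rw [h5]
    ring
-- The seed identity
open Polynomial

theorem qBinomial_succ_succ {q : ℂ} (hq0 : q ≠ 0) (hq1 : ‖q‖ < 1) {N : ℤ} (hN : 0 ≤ N) (k : ℤ) :
    qBinomial q (N + 1) (k + 1) = qBinomial q N (k + 1) + q ^ (N - k) * qBinomial q N k := by
  have h1 := invQFactorial_sub_one hq1 (k + 1)
  have h2 := invQFactorial_sub_one hq1 (N - k)
  rw [add_sub_cancel_right] at h1
  rw [qBinomial_eq, qBinomial_eq, qBinomial_eq, qFactorial_succ q hN, h1,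
    show N + 1 - (k + 1) = N - k by ring, show N - (k + 1) = N - k - 1 by ring, h2]
  have h3 : q ^ (N + 1) = q ^ (N - k) * q ^ (k + 1) := by
    rw [← zpow_add₀ hq0]
    congr 1
    ring
  rw [h3]
  ring

/-- The polynomial `(-c r X; r ^ 2)_N`. -/
noncomputable def gaussPoly (r c : ℂ) (N : ℕ) : ℂ[X] :=
  ∏ i ∈ range N, (1 + C (c * r ^ (2 * i + 1)) * X)

/-- The finite q-binomial theorem, by Pascal's rule. -/
theorem coeff_gaussPoly {r : ℂ} (hr0 : r ≠ 0) (hr1 : ‖r ^ 2‖ < 1) (c : ℂ) (N k : ℕ) :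
    (gaussPoly r c N).coeff k = c ^ k * r ^ (k ^ 2) * qBinomial (r ^ 2) N k := by
  have hp0 : r ^ 2 ≠ 0 := pow_ne_zero 2 hr0
  induction N generalizing k with
  | zero =>
    rcases Nat.eq_zero_or_pos k with rfl | hk
    · simp [gaussPoly, qBinomial, qPochhammer]
    · have : qBinomial (r ^ 2) (0 : ℕ) k = 0 := by
        rw [qBinomial, if_neg (by push_cast; omega)]
      rw [this, mul_zero, gaussPoly, prod_range_zero, coeff_one, if_neg (by omega)]
  | succ N ih =>
    rw [gaussPoly, prod_range_succ, ← gaussPoly, mul_add, mul_one, coeff_add]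
    rcases k with _ | k
    · have h : ∀ n : ℕ, qBinomial (r ^ 2) n (0 : ℕ) = 1 := fun n => by
        have := qFactorial_mul_inv hr1 (n := (n : ℤ)) (by omega)
        rw [qBinomial_eq, Nat.cast_zero, invQFactorial_zero, mul_one, sub_zero, this]
      rw [ih, h, h, mul_coeff_zero]
      simp
    · rw [← mul_assoc, coeff_mul_X, coeff_mul_C, ih, ih, Nat.cast_succ, Nat.cast_succ,
        qBinomial_succ_succ hp0 hr1 (by omega)]
      have hz : r ^ ((k + 1) ^ 2) * (r ^ 2) ^ ((N : ℤ) - k) = r ^ (k ^ 2) * r ^ (2 * N + 1) := by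
        rw [← zpow_natCast r 2, ← zpow_mul, ← zpow_natCast r ((k + 1) ^ 2),
          ← zpow_natCast r (k ^ 2), ← zpow_natCast r (2 * N + 1), ← zpow_add₀ hr0, ← zpow_add₀ hr0]
        congr 1
        push_cast
        ring
      linear_combination (-c ^ (k + 1) * qBinomial (r ^ 2) N k) * hz

/-- Coefficients of a polynomial, with integer index. -/
noncomputable def intCoeff (P : ℂ[X]) (k : ℤ) : ℂ := if 0 ≤ k then P.coeff k.toNat else 0

theorem intCoeff_mul (P Q : ℂ[X]) {m L : ℤ} (hm : m ≤ L) :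
    intCoeff (P * Q) m = ∑ s ∈ Icc 0 L, intCoeff P s * intCoeff Q (m - s) := by
  by_cases h : 0 ≤ m
  · rw [intCoeff, if_pos h, coeff_mul, Nat.sum_antidiagonal_eq_sum_range_succ_mk]
    lift m to ℕ using h
    rw [Int.toNat_natCast]
    trans ∑ s ∈ Icc (0 : ℤ) m, intCoeff P s * intCoeff Q (m - s)
    · rw [← sum_range_eq_sum_Icc_int m (fun s => intCoeff P s * intCoeff Q (m - s))]
      apply sum_congr rfl
      intro k hk
      rw [mem_range] at hk
      rw [intCoeff, intCoeff, if_pos (by omega), if_pos (by omega), Int.toNat_natCast,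
        show ((m : ℤ) - k).toNat = m - k by omega]
    · apply sum_subset (Icc_subset_Icc le_rfl hm)
      intro s h1 h2
      rw [mem_Icc] at h1 h2
      rw [intCoeff, intCoeff, if_neg (c := 0 ≤ (m : ℤ) - s) (by omega), mul_zero]
  · rw [intCoeff, if_neg h, sum_eq_zero]
    intro s hs
    rw [mem_Icc] at hs
    rw [intCoeff, intCoeff, if_neg (c := 0 ≤ m - s) (by omega), mul_zero]

theorem intCoeff_gaussPoly {r : ℂ} (hr0 : r ≠ 0) (hr1 : ‖r ^ 2‖ < 1) (c : ℂ) (N : ℕ) (k : ℤ) :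
    intCoeff (gaussPoly r c N) k = c ^ k * r ^ (k ^ 2) * qBinomial (r ^ 2) N k := by
  by_cases hk : 0 ≤ k
  · lift k to ℕ using hk
    rw [intCoeff, if_pos (by omega), Int.toNat_natCast, coeff_gaussPoly hr0 hr1]
    norm_cast
  · rw [intCoeff, if_neg hk, qBinomial, if_neg (by omega), mul_zero]

/-- The odd exponents of q are sorted into the classes 1, 5 and 3 modulo 6. -/
theorem gaussPoly_three_mul {q : ℂ} (hq0 : q ≠ 0) (M : ℕ) :
    gaussPoly q 1 (3 * M) = gaussPoly (q ^ 3) (q ^ 2)⁻¹ M *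
      (gaussPoly (q ^ 3) (q ^ 2) M * gaussPoly (q ^ 3) 1 M) := by
  induction M with
  | zero => simp [gaussPoly]
  | succ M ih =>
    have h1 : ∀ (r c : ℂ) (N : ℕ), gaussPoly r c (N + 1) =
        gaussPoly r c N * (1 + C (c * r ^ (2 * N + 1)) * X) := fun r c N => by
      rw [gaussPoly, prod_range_succ, gaussPoly]
    rw [show 3 * (M + 1) = 3 * M + 1 + 1 + 1 by ring, h1, h1, h1, h1, h1, h1, ih]
    have e1 : (q ^ 2)⁻¹ * (q ^ 3) ^ (2 * M + 1) = 1 * q ^ (2 * (3 * M) + 1) := by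
      field_simp
      ring
    have e2 : q ^ 2 * (q ^ 3) ^ (2 * M + 1) = 1 * q ^ (2 * (3 * M + 1 + 1) + 1) := by ring
    have e3 : 1 * (q ^ 3) ^ (2 * M + 1) = 1 * q ^ (2 * (3 * M + 1) + 1) := by ring
    rw [e1, e2, e3]
    ring

theorem sum_sum_qBinomial {q : ℂ} (hq0 : q ≠ 0) (hq1 : ‖q‖ < 1) (M : ℕ) {m L : ℤ} (hm : m ≤ L) :
    ∑ s ∈ Icc 0 L, ∑ t ∈ Icc 0 L,
      ((q ^ 2)⁻¹ ^ s * (q ^ 3) ^ (s ^ 2) * qBinomial ((q ^ 3) ^ 2) M s) *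
      (((q ^ 2) ^ t * (q ^ 3) ^ (t ^ 2) * qBinomial ((q ^ 3) ^ 2) M t) *
        ((q ^ 3) ^ ((m - s - t) ^ 2) * qBinomial ((q ^ 3) ^ 2) M (m - s - t))) =
      q ^ (m ^ 2) * qBinomial (q ^ 2) (3 * M) m := by
  have hr0 : q ^ 3 ≠ 0 := pow_ne_zero 3 hq0
  have hr1 : ‖(q ^ 3) ^ 2‖ < 1 := by
    rw [← pow_mul, norm_pow]
    exact pow_lt_one₀ (norm_nonneg q) hq1 (by norm_num)
  have hq2 : ‖q ^ 2‖ < 1 := by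
    rw [norm_pow]
    exact pow_lt_one₀ (norm_nonneg q) hq1 (by norm_num)
  have key := congrArg (fun P => intCoeff P m) (gaussPoly_three_mul hq0 M)
  rw [intCoeff_gaussPoly hq0 hq2, intCoeff_mul _ _ hm, one_zpow, one_mul] at key
  push_cast at key
  rw [key]
  apply sum_congr rfl
  intro s hs
  rw [mem_Icc] at hs
  rw [intCoeff_mul _ _ (show m - s ≤ L by omega), mul_sum]
  apply sum_congr rfl
  intro t _
  rw [intCoeff_gaussPoly hr0 hr1, intCoeff_gaussPoly hr0 hr1, intCoeff_gaussPoly hr0 hr1, one_zpow,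
    one_mul]

/-- A linearisation formula: reflected Saalschütz with lower parameters 0, x - M, y - M. -/
theorem qBinomial_mul_qBinomial {p : ℂ} (hp0 : p ≠ 0) (hp1 : ‖p‖ < 1) {M x y L : ℤ} (hM : 0 ≤ M)
    (hx : x ≤ L) :
    qBinomial p (M + y) x * qBinomial p (M + x) y = ∑ u ∈ Icc 0 L,
      p ^ ((x - u) * (y - u)) * (qBinomial p M (x - u) * qBinomial p M (y - u) *
        qBinomial p (2 * M + u) (2 * M)) := by
  have key := saalschutz_int_reflect hp0 hp1 x y 0 (x - M) (y - M) (Icc 0 L)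
    (fun u h1 h2 h3 h4 h5 => by rw [mem_Icc]; omega)
  have h1 := qFactorial_mul_inv hp1 (show 0 ≤ 2 * M by omega)
  have h2 := qFactorial_mul_inv hp1 hM
  have h3 : ∀ u ∈ Icc 0 L, p ^ ((x - u) * (y - u)) * (qBinomial p M (x - u) *
      qBinomial p M (y - u) * qBinomial p (2 * M + u) (2 * M)) =
      (qFactorial p M * qFactorial p M * invQFactorial p (2 * M)) * (p ^ ((x - u) * (y - u)) *
      qFactorial p (u + x + y - 0 - (x - M) - (y - M)) *
      invQFactorial p (x - u) * invQFactorial p (y - u) * invQFactorial p (u - 0) *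
      invQFactorial p (u - (x - M)) * invQFactorial p (u - (y - M))) := by
    intro u _
    simp only [qBinomial_eq]
    rw [show 2 * M + u - 2 * M = u - 0 by ring,
      show u + x + y - 0 - (x - M) - (y - M) = 2 * M + u by ring,
      show u - (x - M) = M - (x - u) by ring, show u - (y - M) = M - (y - u) by ring]
    ring
  rw [sum_congr rfl h3, ← mul_sum, key, qBinomial_eq, qBinomial_eq,
    show x + y - 0 - (x - M) = M + y by ring, show x + y - 0 - (y - M) = M + x by ring,
    show x + y - (x - M) - (y - M) = 2 * M by ring, show x - (x - M) = M by ring,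
    show y - (y - M) = M by ring, show y - (x - M) = M + y - x by ring,
    show x - (y - M) = M + x - y by ring, sub_zero, sub_zero]
  trans (qFactorial p (M + y) * invQFactorial p x * invQFactorial p (M + y - x)) *
    (qFactorial p (M + x) * invQFactorial p y * invQFactorial p (M + x - y)) *
    (qFactorial p (2 * M) * invQFactorial p (2 * M)) *
    (qFactorial p M * invQFactorial p M) * (qFactorial p M * invQFactorial p M)
  · rw [h1, h2]
    ring
  · ring

/-- The seed identity of the hierarchy. -/
theorem sum_refinedTrinomial_diagonal {q : ℂ} (hq0 : q ≠ 0) (hq1 : ‖q‖ < 1) (M : ℕ) {L B : ℤ}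
    (hB : L ≤ B) :
    ∑ j ∈ Icc (-B) B, q ^ (3 * j ^ 2 + 2 * j) * refinedTrinomial (q ^ 3) L M j j =
      ∑ u ∈ Icc 0 L, q ^ ((L - 2 * u) ^ 2) * qBinomial (q ^ 2) (3 * M) (L - 2 * u) *
        qBinomial ((q ^ 3) ^ 2) (2 * M + u) (2 * M) := by
  have hr0 : q ^ 3 ≠ 0 := pow_ne_zero 3 hq0
  have hp0 : (q ^ 3) ^ 2 ≠ 0 := pow_ne_zero 2 hr0
  have hr1 : ‖(q ^ 3) ^ 2‖ < 1 := by
    rw [← pow_mul, norm_pow]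
    exact pow_lt_one₀ (norm_nonneg q) hq1 (by norm_num)
  simp only [refinedTrinomial, mul_sum]
  rw [sum_comm]
  -- Setting y = x + j makes the summand symmetric in x and y apart from the linear exponent 2(y -
  -- x).
  have h1 : ∀ x ∈ Icc 0 L, ∑ j ∈ Icc (-B) B, q ^ (3 * j ^ 2 + 2 * j) *
      ((q ^ 3) ^ ((L - 2 * x - j) ^ 2) * qBinomial ((q ^ 3) ^ 2) M (L - 2 * x - j) *
        qBinomial ((q ^ 3) ^ 2) (M + j + x) x *
        qBinomial ((q ^ 3) ^ 2) (M - j + (x + j)) (x + j)) =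
      ∑ y ∈ Icc 0 L, q ^ (3 * (y - x) ^ 2 + 2 * (y - x)) *
      ((q ^ 3) ^ ((L - x - y) ^ 2) * qBinomial ((q ^ 3) ^ 2) M (L - x - y) *
        qBinomial ((q ^ 3) ^ 2) (M + y) x * qBinomial ((q ^ 3) ^ 2) (M + x) y) := by
    intro x hx
    rw [mem_Icc] at hx
    have hsupp : ∀ y, q ^ (3 * (y - x) ^ 2 + 2 * (y - x)) *
      ((q ^ 3) ^ ((L - x - y) ^ 2) * qBinomial ((q ^ 3) ^ 2) M (L - x - y) *
        qBinomial ((q ^ 3) ^ 2) (M + y) x * qBinomial ((q ^ 3) ^ 2) (M + x) y) ≠ 0 →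
        0 ≤ y ∧ x + y ≤ L := by
      intro y h
      simp only [mul_ne_zero_iff] at h
      obtain ⟨_, ⟨⟨_, h1⟩, _⟩, h2⟩ := h
      have := le_of_qBinomial_ne_zero h1
      have := le_of_qBinomial_ne_zero h2
      omega
    symm
    rw [sum_int_shift (t := Icc (-B) B) x
      (fun y h => by have := hsupp y h; rw [mem_Icc]; omega)
      (fun y h => by have := hsupp y h; rw [mem_Icc]; omega)]
    apply sum_congr rfl
    intro j _
    rw [show j + x - x = j by ring, show L - x - (j + x) = L - 2 * x - j by ring,
      show (M : ℤ) + (j + x) = M + j + x by ring, show (M : ℤ) - j + (x + j) = M + x by ring,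
      add_comm x j]
  have h2 : ∀ x ∈ Icc 0 L, ∀ y ∈ Icc 0 L, q ^ (3 * (y - x) ^ 2 + 2 * (y - x)) *
      ((q ^ 3) ^ ((L - x - y) ^ 2) * qBinomial ((q ^ 3) ^ 2) M (L - x - y) *
        qBinomial ((q ^ 3) ^ 2) (M + y) x * qBinomial ((q ^ 3) ^ 2) (M + x) y) =
      ∑ u ∈ Icc 0 L, ((q ^ 2)⁻¹ ^ (x - u) * (q ^ 3) ^ ((x - u) ^ 2) *
        qBinomial ((q ^ 3) ^ 2) M (x - u)) *
      (((q ^ 2) ^ (y - u) * (q ^ 3) ^ ((y - u) ^ 2) * qBinomial ((q ^ 3) ^ 2) M (y - u)) *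
        ((q ^ 3) ^ ((L - x - y) ^ 2) * qBinomial ((q ^ 3) ^ 2) M (L - x - y))) *
        qBinomial ((q ^ 3) ^ 2) (2 * M + u) (2 * M) := by
    intro x hx y _
    rw [mem_Icc] at hx
    rw [mul_assoc ((q ^ 3) ^ ((L - x - y) ^ 2) * qBinomial ((q ^ 3) ^ 2) M (L - x - y)),
      qBinomial_mul_qBinomial hp0 hr1 (by omega) hx.2, mul_sum, mul_sum]
    apply sum_congr rfl
    intro u _
    -- With s = x - u and t = y - u this is 3(t-s)² + 6st = 3s² + 3t²: the cross term cancels, and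
    -- s, t separate.
    have hz : q ^ (3 * (y - x) ^ 2 + 2 * (y - x)) * ((q ^ 3) ^ 2) ^ ((x - u) * (y - u)) =
        (q ^ 2)⁻¹ ^ (x - u) * (q ^ 3) ^ ((x - u) ^ 2) *
        ((q ^ 2) ^ (y - u) * (q ^ 3) ^ ((y - u) ^ 2)) := by
      rw [← pow_mul, inv_zpow', ← zpow_natCast q 2, ← zpow_natCast q 3, ← zpow_natCast q (3 * 2)]
      simp only [← zpow_mul, ← zpow_add₀ hq0]
      congr 1
      push_cast
      ring
    linear_combination ((q ^ 3) ^ ((L - x - y) ^ 2) * qBinomial ((q ^ 3) ^ 2) M (L - x - y) *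
      (qBinomial ((q ^ 3) ^ 2) M (x - u) * qBinomial ((q ^ 3) ^ 2) M (y - u) *
        qBinomial ((q ^ 3) ^ 2) (2 * M + u) (2 * M))) * hz
  rw [sum_congr rfl h1, sum_congr rfl (fun x hx => sum_congr rfl (h2 x hx)),
    sum_congr rfl (fun x _ => sum_comm), sum_comm]
  apply sum_congr rfl
  intro u hu
  rw [mem_Icc] at hu
  rw [← sum_sum_qBinomial hq0 hq1 M (show L - 2 * u ≤ L by omega), sum_mul]
  have hsupp : ∀ x y, ((q ^ 2)⁻¹ ^ (x - u) * (q ^ 3) ^ ((x - u) ^ 2) *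
        qBinomial ((q ^ 3) ^ 2) M (x - u)) *
      (((q ^ 2) ^ (y - u) * (q ^ 3) ^ ((y - u) ^ 2) * qBinomial ((q ^ 3) ^ 2) M (y - u)) *
        ((q ^ 3) ^ ((L - x - y) ^ 2) * qBinomial ((q ^ 3) ^ 2) M (L - x - y))) *
        qBinomial ((q ^ 3) ^ 2) (2 * M + u) (2 * M) ≠ 0 →
      (x ∈ Icc 0 L ∧ x - u ∈ Icc 0 L) ∧ (y ∈ Icc 0 L ∧ y - u ∈ Icc 0 L) := by
    intro x y h
    simp only [mul_ne_zero_iff] at h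
    obtain ⟨⟨⟨_, h1⟩, ⟨⟨_, h2⟩, ⟨_, h3⟩⟩⟩, _⟩ := h
    have := le_of_qBinomial_ne_zero h1
    have := le_of_qBinomial_ne_zero h2
    have := le_of_qBinomial_ne_zero h3
    simp only [mem_Icc]
    omega
  rw [sum_congr rfl (fun x _ => sum_int_shift (t := Icc 0 L) u
    (fun y h => (hsupp x y h).2.1) (fun y h => (hsupp x y h).2.2)), sum_comm,
    sum_congr rfl (fun y _ => sum_int_shift (t := Icc 0 L) u
    (fun x h => (hsupp x (y + u) h).1.1) (fun x h => (hsupp x (y + u) h).1.2)), sum_comm]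
  apply sum_congr rfl
  intro s _
  rw [sum_mul]
  apply sum_congr rfl
  intro t _
  rw [add_sub_cancel_right, add_sub_cancel_right,
    show L - (s + u) - (t + u) = L - 2 * u - s - t by ring]

/-! ### Iteration along the multisum -/

theorem tailSum_eq_sum_ite {ν : ℕ} (n : Fin ν → ℕ) (k : Fin ν) :
    tailSum n k = ∑ i, if k ≤ i then n i else 0 := by
  rw [tailSum, ← sum_filter]
  congr 1
  ext i
  simp

theorem tailSum_succ {ν : ℕ} (n : Fin (ν + 1) → ℕ) (k : Fin ν) :
    tailSum n k.succ = tailSum (Fin.tail n) k := by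
  rw [tailSum_eq_sum_ite, tailSum_eq_sum_ite, Fin.sum_univ_succ]
  simp [Fin.tail]

theorem tailSum_zero {ν : ℕ} (n : Fin (ν + 2) → ℕ) :
    tailSum n 0 = n 0 + tailSum (Fin.tail n) 0 := by
  rw [tailSum_eq_sum_ite, tailSum_eq_sum_ite, Fin.sum_univ_succ]
  simp [Fin.tail]

theorem le_sum_tailSum {ν : ℕ} (n : Fin ν → ℕ) (i : Fin ν) : n i ≤ ∑ k, tailSum n k :=
  (single_le_sum (f := n) (fun _ _ => Nat.zero_le _) (mem_Ici.2 le_rfl)).trans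
    (single_le_sum (f := tailSum n) (fun _ _ => Nat.zero_le _) (mem_univ i))

theorem le_of_hierarchyTerm_ne_zero {ν : ℕ} {hν : 0 < ν} {L : ℕ} {q : ℂ} {m : ℕ} {n : Fin ν → ℕ}
    (h : hierarchyTerm ν hν L q m n ≠ 0) : m + ∑ k, tailSum n k ≤ L := by
  rw [hierarchyTerm] at h
  split_ifs at h with hc
  · simp only [mul_ne_zero_iff] at h
    have h1 := le_of_qBinomial_ne_zero h.1.2
    have h2 : (∑ k, (tailSum n k : ℤ)) = ((∑ k, tailSum n k : ℕ) : ℤ) := by push_cast; rfl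
    rw [h2] at h1
    omega
  · exact absurd rfl h

theorem finite_support_hierarchyTerm (ν : ℕ) (hν : 0 < ν) (L : ℕ) (q : ℂ) :
    (Function.support fun p : ℕ × (Fin ν → ℕ) => hierarchyTerm ν hν L q p.1 p.2).Finite := by
  apply (finite_toSet (range (L + 1) ×ˢ Fintype.piFinset fun _ : Fin ν => range (L + 1))).subset
  rintro ⟨m, n⟩ h
  have h1 : m + ∑ k, tailSum n k ≤ L := le_of_hierarchyTerm_ne_zero h
  rw [mem_coe, mem_product, Fintype.mem_piFinset, mem_range]
  refine ⟨by simp only; omega, fun i => ?_⟩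
  have := le_sum_tailSum n i
  rw [mem_range]
  simp only
  omega

/-- The case split is forced by the natural-number difference L - N_1; when N_1 > L the binomial
attached to n_1 is already zero. -/
theorem hierarchyTerm_succ (ν : ℕ) (L : ℕ) (q : ℂ) (m : ℕ) (n : Fin (ν + 2) → ℕ) :
    hierarchyTerm (ν + 2) (Nat.succ_pos _) L q m n =
      if tailSum n 0 ≤ L then
        q ^ (3 * tailSum n 0 ^ 2) * qBinomial (q ^ 6) ((L : ℤ) - tailSum n 0 + n 0) (n 0) *
          hierarchyTerm (ν + 1) (Nat.succ_pos _) (L - tailSum n 0) q m (Fin.tail n)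
      else 0 := by
  have hlast : lastIndex (ν + 2) (Nat.succ_pos _) = (lastIndex (ν + 1) (Nat.succ_pos _)).succ := by
    ext
    simp [lastIndex]
  have hprod : ∏ j ∈ Iio (lastIndex (ν + 2) (Nat.succ_pos _)),
      qBinomial (q ^ 6) ((L : ℤ) - ∑ l ∈ Iic j, (tailSum n l : ℤ) + n j) (n j) =
      qBinomial (q ^ 6) ((L : ℤ) - tailSum n 0 + n 0) (n 0) *
      ∏ j ∈ Iio (lastIndex (ν + 1) (Nat.succ_pos _)),
        qBinomial (q ^ 6) ((L : ℤ) - tailSum n 0 -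
          ∑ l ∈ Iic j, (tailSum (Fin.tail n) l : ℤ) + Fin.tail n j) (Fin.tail n j) := by
    have e1 : ∀ (μ : ℕ) (k : Fin μ) (f : Fin μ → ℂ),
        ∏ j ∈ Iio k, f j = ∏ j, if j < k then f j else 1 := by
      intro μ k f
      rw [← prod_filter]
      congr 1
      ext i
      simp
    have e2 : ∀ (μ : ℕ) (k : Fin μ) (f : Fin μ → ℤ),
        ∑ j ∈ Iic k, f j = ∑ j, if j ≤ k then f j else 0 := by
      intro μ k f
      rw [← sum_filter]
      congr 1
      ext i
      simp
    simp only [e1, e2]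
    rw [Fin.prod_univ_succ, hlast]
    congr 1
    · simp
    · apply prod_congr rfl
      intro j _
      simp only [Fin.succ_lt_succ_iff]
      congr 1
      rw [Fin.sum_univ_succ]
      simp only [Fin.zero_le, if_true, Fin.succ_le_succ_iff, tailSum_succ, Fin.tail, sub_sub]
  have hsum : ∑ k, tailSum n k = tailSum n 0 + ∑ k, tailSum (Fin.tail n) k := by
    rw [Fin.sum_univ_succ]
    simp only [tailSum_succ]
  have hsum2 : ∑ k, tailSum n k ^ 2 = tailSum n 0 ^ 2 + ∑ k, tailSum (Fin.tail n) k ^ 2 := by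
    rw [Fin.sum_univ_succ]
    simp only [tailSum_succ]
  have hsumz : ∑ k, (tailSum n k : ℤ) = tailSum n 0 + ∑ k, (tailSum (Fin.tail n) k : ℤ) := by
    rw [Fin.sum_univ_succ]
    simp only [tailSum_succ]
  rw [hierarchyTerm, hprod, hsum, hsum2, hsumz, hlast]
  by_cases hN : tailSum n 0 ≤ L
  · rw [if_pos hN, hierarchyTerm]
    have hc : (L + m ≡ tailSum n 0 + ∑ k, tailSum (Fin.tail n) k [MOD 2]) ↔
        (L - tailSum n 0 + m ≡ ∑ k, tailSum (Fin.tail n) k [MOD 2]) := by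
      unfold Nat.ModEq
      omega
    simp only [hc]
    split_ifs with h
    · rw [Nat.cast_sub hN, show (L : ℤ) - m - (tailSum n 0 + ∑ k, (tailSum (Fin.tail n) k : ℤ)) =
        L - tailSum n 0 - m - ∑ k, (tailSum (Fin.tail n) k : ℤ) by ring]
      simp only [Fin.tail]
      ring
    · rw [mul_zero]
  · have h0 : qBinomial (q ^ 6) ((L : ℤ) - tailSum n 0 + n 0) (n 0) = 0 := by
      rw [qBinomial, if_neg (by omega)]
    rw [if_neg hN, h0]
    simp

/-- The sums over `j` of the hierarchy before the last transformation. -/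
noncomputable def hierarchySum (q : ℂ) (B : ℤ) (ν : ℕ) (L M : ℤ) : ℂ :=
  ∑ j ∈ Icc (-B) B, q ^ (3 * ((ν : ℤ) + 1) * j ^ 2 + 2 * j) *
    refinedTrinomial (q ^ 3) L M (((ν : ℤ) + 1) * j) j

theorem hierarchySum_succ {q : ℂ} (hq0 : q ≠ 0) (hq1 : ‖q‖ < 1) (B : ℤ) (ν : ℕ) {L : ℤ} (M : ℤ)
    (hL : 0 ≤ L) :
    ∑ i ∈ Icc 0 L, (q ^ 3) ^ (i ^ 2) * qBinomial ((q ^ 3) ^ 2) (L + M - i) L *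
      hierarchySum q B ν (L - i) i = hierarchySum q B (ν + 1) L M := by
  have hr0 : q ^ 3 ≠ 0 := pow_ne_zero 3 hq0
  have hr1 : ‖(q ^ 3) ^ 2‖ < 1 := by
    rw [← pow_mul, norm_pow]
    exact pow_lt_one₀ (norm_nonneg q) hq1 (by norm_num)
  simp only [hierarchySum, mul_sum]
  rw [sum_comm]
  apply sum_congr rfl
  intro j _
  have key := refinedTrinomial_transform hr0 hr1 M hL (c := (ν : ℤ) + 1) (by omega) j
  have hz : q ^ (3 * (((ν + 1 : ℕ) : ℤ) + 1) * j ^ 2 + 2 * j) =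
      q ^ (3 * ((ν : ℤ) + 1) * j ^ 2 + 2 * j) * (q ^ 3) ^ (j ^ 2) := by
    rw [← zpow_natCast q 3, ← zpow_mul, ← zpow_add₀ hq0]
    congr 1
    push_cast
    ring
  rw [hz, Nat.cast_succ, mul_assoc (q ^ (3 * ((ν : ℤ) + 1) * j ^ 2 + 2 * j)), ← key, mul_sum]
  apply sum_congr rfl
  intro i _
  ring

theorem hierarchySum_limit {q : ℂ} (hq0 : q ≠ 0) (hq1 : ‖q‖ < 1) (B : ℤ) (ν : ℕ) (L : ℕ) :
    ∑ i ∈ Icc (0 : ℤ) L, (q ^ 3) ^ (i ^ 2) * hierarchySum q B ν (L - i) i =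
      ∑ j ∈ Icc (-B) B, q ^ (3 * (((ν + 1 : ℕ) : ℤ) + 1) * j ^ 2 + 2 * j) *
        trinomialT0 (q ^ 3) L ((((ν + 1 : ℕ) : ℤ) + 1) * j) := by
  have hr0 : q ^ 3 ≠ 0 := pow_ne_zero 3 hq0
  have hr1 : ‖(q ^ 3) ^ 2‖ < 1 := by
    rw [← pow_mul, norm_pow]
    exact pow_lt_one₀ (norm_nonneg q) hq1 (by norm_num)
  simp only [hierarchySum, mul_sum]
  rw [sum_comm]
  apply sum_congr rfl
  intro j _
  have key := refinedTrinomial_transform_limit hr0 hr1 L (c := (ν : ℤ) + 1) (by omega) j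
  have hz : q ^ (3 * (((ν + 1 : ℕ) : ℤ) + 1) * j ^ 2 + 2 * j) =
      q ^ (3 * ((ν : ℤ) + 1) * j ^ 2 + 2 * j) * (q ^ 3) ^ (j ^ 2) := by
    rw [← zpow_natCast q 3, ← zpow_mul, ← zpow_add₀ hq0]
    congr 1
    push_cast
    ring
  rw [hz, Nat.cast_succ, mul_assoc (q ^ (3 * ((ν : ℤ) + 1) * j ^ 2 + 2 * j)), ← key, mul_sum]
  apply sum_congr rfl
  intro i _
  ring

theorem hierarchyTerm_one (L : ℕ) (q : ℂ) (m i : ℕ) :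
    hierarchyTerm 1 Nat.one_pos L q m (fun _ => i) = if L + m ≡ i [MOD 2] then
      q ^ (m ^ 2 + 3 * i ^ 2) * qBinomial (q ^ 2) (3 * i) m *
        qBinomial (q ^ 6) (2 * i + ((L : ℤ) - m - i) / 2) (2 * i) else 0 := by
  have h1 : ∀ k : Fin 1, tailSum (fun _ : Fin 1 => i) k = i := by
    intro k
    rw [tailSum_eq_sum_ite, Fin.sum_univ_one, if_pos (Subsingleton.le k 0)]
  have h2 : Iio (lastIndex 1 Nat.one_pos) = ∅ := by
    ext j
    simp [Subsingleton.elim j (lastIndex 1 Nat.one_pos)]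
  rw [hierarchyTerm, h2]
  simp [h1]

/-- The parity condition says exactly that m = L - i - 2u for an integer u, which matches the index
of the seed identity. Only the seed needs B to be large. -/
theorem sum_hierarchyTerm_one {q : ℂ} (hq0 : q ≠ 0) (hq1 : ‖q‖ < 1) {B : ℤ} {L i : ℕ}
    (hB : L ≤ B) :
    ∑ m ∈ range (L + 1), hierarchyTerm 1 Nat.one_pos L q m (fun _ => i) =
      (q ^ 3) ^ ((i : ℤ) ^ 2) * hierarchySum q B 0 (L - i) i := by
  have h := sum_refinedTrinomial_diagonal hq0 hq1 i (L := (L : ℤ) - i) (B := B) (by omega)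
  rw [hierarchySum]
  simp only [Nat.cast_zero, zero_add, mul_one, one_mul]
  rw [h, mul_sum]
  symm
  apply sum_bij_ne_zero (fun u _ _ => ((L : ℤ) - i - 2 * u).toNat)
  · intro u hu _
    rw [mem_Icc] at hu
    rw [mem_range]
    omega
  · intro u _ hu0 v _ hv0 huv
    simp only [mul_ne_zero_iff] at hu0 hv0
    have h1 := le_of_qBinomial_ne_zero hu0.2.1.2
    have h2 := le_of_qBinomial_ne_zero hv0.2.1.2
    omega
  · intro m _ h0
    have h1 := le_of_hierarchyTerm_ne_zero h0
    rw [hierarchyTerm_one] at h0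
    split_ifs at h0 with hc
    · have hm : (L : ℤ) - i - 2 * (((L : ℤ) - m - i) / 2) = m := by
        unfold Nat.ModEq at hc
        omega
      have h2 := le_of_qBinomial_ne_zero (right_ne_zero_of_mul h0)
      refine ⟨((L : ℤ) - m - i) / 2, ?_, ?_, by omega⟩
      · rw [mem_Icc]
        omega
      · simp only [mul_ne_zero_iff] at h0 ⊢
        rw [hm, ← pow_mul]
        refine ⟨zpow_ne_zero _ (pow_ne_zero _ hq0), ⟨zpow_ne_zero _ hq0, ?_⟩, ?_⟩
        · exact h0.1.2
        · exact h0.2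
    · exact absurd rfl h0
  · intro u hu hu0
    simp only [mul_ne_zero_iff] at hu0
    have h1 := le_of_qBinomial_ne_zero hu0.2.1.2
    obtain ⟨m, hm⟩ := Int.eq_ofNat_of_zero_le h1.1
    have hm' : ((L : ℤ) - i - 2 * u).toNat = m := by omega
    have hu2 : u = ((L : ℤ) - m - i) / 2 := by omega
    rw [hm', hierarchyTerm_one, if_pos (by unfold Nat.ModEq; omega), hm, ← hu2, ← pow_mul]
    have hz : (q ^ 3) ^ ((i : ℤ) ^ 2) * q ^ ((m : ℤ) ^ 2) = q ^ (m ^ 2 + 3 * i ^ 2) := by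
      norm_cast
      ring
    rw [← hz]
    ring

theorem tsum_hierarchyTerm_one {q : ℂ} (hq0 : q ≠ 0) (hq1 : ‖q‖ < 1) {B : ℤ} {L : ℕ}
    (hB : L ≤ B) (w : ℤ → ℂ) :
    ∑' p : ℕ × (Fin 1 → ℕ), w (tailSum p.2 0) * hierarchyTerm 1 Nat.one_pos L q p.1 p.2 =
      ∑ i ∈ Icc (0 : ℤ) L, w i * ((q ^ 3) ^ (i ^ 2) * hierarchySum q B 0 (L - i) i) := by
  rw [← (((Equiv.refl ℕ).prodCongr (Equiv.funUnique (Fin 1) ℕ)).symm).tsum_eq,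
    tsum_eq_sum (s := range (L + 1) ×ˢ range (L + 1)), sum_product_right,
    ← sum_range_eq_sum_Icc_int L
      (fun i => w i * ((q ^ 3) ^ (i ^ 2) * hierarchySum q B 0 (L - i) i))]
  · apply sum_congr rfl
    intro i _
    rw [← sum_hierarchyTerm_one hq0 hq1 hB, mul_sum]
    apply sum_congr rfl
    intro m _
    have h1 : tailSum (fun _ : Fin 1 => i) 0 = i := by
      rw [tailSum_eq_sum_ite, Fin.sum_univ_one, if_pos le_rfl]
    change w (tailSum (fun _ : Fin 1 => i) 0) * hierarchyTerm 1 Nat.one_pos L q m (fun _ => i) = _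
    rw [h1]
  · rintro ⟨m, i⟩ h
    change w (tailSum (fun _ : Fin 1 => i) 0) * hierarchyTerm 1 Nat.one_pos L q m (fun _ => i) = 0
    by_contra h0
    apply h
    have h1 := le_of_hierarchyTerm_ne_zero (right_ne_zero_of_mul h0)
    have h2 := le_sum_tailSum (fun _ : Fin 1 => i) 0
    rw [mem_product, mem_range, mem_range]
    simp only at *
    omega

/-- The arbitrary weight w(N_1) makes the induction work: since N_1 = n_1 + N_2, the binomial freed
by removing n_1 equals [L-N_2; N_1-N_2], which for fixed N_1 is a weight in N_2. -/
theorem tsum_hierarchyTerm {q : ℂ} (hq0 : q ≠ 0) (hq1 : ‖q‖ < 1) {B : ℤ} (ν : ℕ) {L : ℕ}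
    (hB : L ≤ B) (w : ℤ → ℂ) :
    ∑' p : ℕ × (Fin (ν + 1) → ℕ), w (tailSum p.2 0) *
      hierarchyTerm (ν + 1) (Nat.succ_pos _) L q p.1 p.2 =
      ∑ i ∈ Icc (0 : ℤ) L, w i * ((q ^ 3) ^ (i ^ 2) * hierarchySum q B ν (L - i) i) := by
  induction ν generalizing L w with
  | zero => exact tsum_hierarchyTerm_one hq0 hq1 hB w
  | succ ν ih =>
    -- N_1 replaces n_1 as a summation variable. The range is cut out by N_1 ≥ N_2, which the
    -- binomial in `h` enforces.
    let φ : ℕ × (Fin (ν + 2) → ℕ) → ℕ × (ℕ × (Fin (ν + 1) → ℕ)) :=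
      fun p => (tailSum p.2 0, (p.1, Fin.tail p.2))
    let h : ℕ × (ℕ × (Fin (ν + 1) → ℕ)) → ℂ := fun z =>
      if z.1 ≤ L then w z.1 * q ^ (3 * z.1 ^ 2) *
        (qBinomial (q ^ 6) ((L : ℤ) - tailSum z.2.2 0) ((z.1 : ℤ) - tailSum z.2.2 0) *
          hierarchyTerm (ν + 1) (Nat.succ_pos _) (L - z.1) q z.2.1 z.2.2)
      else 0
    have hφ : Function.Injective φ := by
      rintro ⟨m, n⟩ ⟨m', n'⟩ he
      simp only [φ, Prod.mk.injEq] at he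
      obtain ⟨h1, rfl, h2⟩ := he
      rw [tailSum_zero, tailSum_zero, h2] at h1
      have h3 : n 0 = n' 0 := by omega
      rw [← Fin.cons_self_tail n, ← Fin.cons_self_tail n', h2, h3]
    have hh : ∀ p : ℕ × (Fin (ν + 2) → ℕ), w (tailSum p.2 0) *
        hierarchyTerm (ν + 2) (Nat.succ_pos _) L q p.1 p.2 = h (φ p) := by
      rintro ⟨m, n⟩
      simp only [h, φ]
      rw [hierarchyTerm_succ]
      split_ifs with hN
      · have h1 := tailSum_zero n
        rw [show (L : ℤ) - tailSum (Fin.tail n) 0 = L - tailSum n 0 + n 0 by omega,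
          show (tailSum n 0 : ℤ) - tailSum (Fin.tail n) 0 = n 0 by omega]
        ring
      · rw [mul_zero]
    have hsub : Function.support h ⊆ Set.range φ := by
      rintro ⟨N, m, n⟩ hz
      rw [Function.mem_support] at hz
      simp only [h] at hz
      split_ifs at hz with hN
      · have h1 := le_of_qBinomial_ne_zero (left_ne_zero_of_mul (right_ne_zero_of_mul hz))
        refine ⟨(m, Fin.cons (N - tailSum n 0) n), ?_⟩
        simp only [φ, tailSum_zero, Fin.tail_cons, Fin.cons_zero, Prod.mk.injEq, and_true]
        omega
      · exact absurd rfl hz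
    have hfin : (Function.support h).Finite := by
      have hf : (⋃ N ∈ range (L + 1), ({N} : Set ℕ) ×ˢ (Function.support
          fun p : ℕ × (Fin (ν + 1) → ℕ) =>
            hierarchyTerm (ν + 1) (Nat.succ_pos _) (L - N) q p.1 p.2)).Finite :=
        Set.Finite.biUnion (finite_toSet _) fun N _ =>
          (Set.finite_singleton N).prod (finite_support_hierarchyTerm _ _ _ _)
      apply hf.subset
      rintro ⟨N, m, n⟩ hz
      rw [Function.mem_support] at hz
      simp only [h] at hz
      split_ifs at hz with hN
      · rw [Set.mem_iUnion₂]
        exact ⟨N, mem_range.2 (by omega), rfl, right_ne_zero_of_mul (right_ne_zero_of_mul hz)⟩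
      · exact absurd rfl hz
    rw [tsum_congr hh, hφ.tsum_eq hsub,
      (summable_of_hasFiniteSupport hfin).tsum_prod, tsum_eq_sum (s := range (L + 1)),
      ← sum_range_eq_sum_Icc_int L
        (fun i => w i * ((q ^ 3) ^ (i ^ 2) * hierarchySum q B (ν + 1) (L - i) i))]
    · apply sum_congr rfl
      intro N hN
      rw [mem_range] at hN
      have hN' : N ≤ L := by omega
      simp only [h, if_pos hN']
      rw [tsum_mul_left, ih (by omega)
        (fun x => qBinomial (q ^ 6) ((L : ℤ) - x) ((N : ℤ) - x)), Nat.cast_sub hN',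
        ← hierarchySum_succ hq0 hq1 B ν N (by omega), mul_assoc]
      congr 1
      have hz : q ^ (3 * N ^ 2) = (q ^ 3) ^ ((N : ℤ) ^ 2) := by
        rw [pow_mul]
        norm_cast
      rw [hz]
      congr 1
      apply sum_congr rfl
      intro i _
      -- Reflecting the lower entry to L - N puts the weight in the form of the transformation
      -- kernel, with L - N for L and N for M.
      rw [← qBinomial_symm, ← pow_mul, show (L : ℤ) - i - (N - i) = L - N by ring,
        show (L : ℤ) - N + N - i = L - i by ring]
      ring
    · intro N hN
      rw [mem_range] at hN
      simp only [h, if_neg (show ¬ N ≤ L by omega), tsum_zero]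

end QHierarchy

theorem mainTheorem11 (ν : ℕ) (hν : 0 < ν) (L : ℕ) (q : ℂ) (hq0 : q ≠ 0) (hq1 : ‖q‖ < 1) :
    Summable (fun p : ℕ × (Fin ν → ℕ) => QHierarchy.hierarchyTerm ν hν L q p.1 p.2) ∧
    Summable (fun j : ℤ => q ^ (3 * ((ν : ℤ) + 1) * j ^ 2 + 2 * j) *
      QHierarchy.trinomialT0 (q ^ 3) L (((ν : ℤ) + 1) * j)) ∧
    ∑' p : ℕ × (Fin ν → ℕ), QHierarchy.hierarchyTerm ν hν L q p.1 p.2 =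
      ∑' j : ℤ, q ^ (3 * ((ν : ℤ) + 1) * j ^ 2 + 2 * j) *
        QHierarchy.trinomialT0 (q ^ 3) L (((ν : ℤ) + 1) * j) := by
  have hr0 : q ^ 3 ≠ 0 := pow_ne_zero 3 hq0
  -- T₀(L;a) vanishes for |a| > L, so truncating the bilateral sum at B = L loses nothing.
  have hzero : ∀ j : ℤ, j ∉ Icc (-(L : ℤ)) L → q ^ (3 * ((ν : ℤ) + 1) * j ^ 2 + 2 * j) *
      QHierarchy.trinomialT0 (q ^ 3) L (((ν : ℤ) + 1) * j) = 0 := by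
    intro j hj
    rw [mem_Icc, ← abs_le, not_le] at hj
    rw [QHierarchy.trinomialT0_eq_zero hr0, mul_zero]
    rw [abs_mul, abs_of_nonneg (by omega : (0 : ℤ) ≤ (ν : ℤ) + 1)]
    nlinarith
  refine ⟨summable_of_hasFiniteSupport (QHierarchy.finite_support_hierarchyTerm ν hν L q),
    summable_of_ne_finset_zero hzero, ?_⟩
  rw [tsum_eq_sum hzero]
  obtain ⟨μ, rfl⟩ : ∃ μ, ν = μ + 1 := ⟨ν - 1, by omega⟩
  have key := QHierarchy.tsum_hierarchyTerm hq0 hq1 (B := L) μ le_rfl (fun _ => 1)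
  simp only [one_mul] at key
  rw [key, QHierarchy.hierarchySum_limit hq0 hq1]
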